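/- Write $\mathbb{R}_*=(0,\infty)$, let $\mathcal{M}_{+,b}(\mathbb{R}_*)$ be the set of positive bounded Radon measures on $\mathbb{R}_*$ with the weak-* topology (duality with $C_0(\mathbb{R}_*)$), and put $M_p(\mu)=\int_{\mathbb{R}_*} x^p\,\mu(dx)\in[0,\infty]$. Let $\gamma,\lambda\in\mathbb{R}$ satisfy $-\lambda<1$ and $\gamma+\lambda<1$ (so that $|\gamma+2\lambda|\ge 1$ and $\gamma>1$ are allowed). Let $K:\mathbb{R}_*^2\to[0,\infty)$ be continuous and such that, for some constants $0<c_1\le c_2<\infty$ and all $x,y\in\mathbb{R}_*$, $$c_1\left(x^{\gamma+\lambda}y^{-\lambda}+x^{-\lambda}y^{\gamma+\lambda}\right)\le K(x,y)\le c_2\left(x^{\gamma+\lambda}y^{-\lambda}+x^{-\lambda}y^{\gamma+\lambda}\right).$$ Let $a>0$, and let $f_0,\eta\in\mathcal{M}_{+,b}(\mathbb{R}_*)$ have supports contained in $[a,\infty)$ and finite first moments, $M_1(f_0)<\infty$ and $M_1(\eta)<\infty$. Then for every $T>0$ there exists $f\in C([0,T],\mathcal{M}_{+,b}(\mathbb{R}_*))$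 which is a weak solution on $[0,T]$ of the coagulation equation with kernel $K$, source $\eta$ and initial datum $f_0$, that is: 1. the support of $f_t$ is contained in $[a,\infty)$ for every $t\in[0,T]$; 2. $\sup_{t\in[0,T]}M_1(f_t)<\infty$, $\int_0^T M_{-\lambda}(f_t)\,dt<\infty$ and $\int_0^T M_{\gamma+\lambda}(f_t)\,dt<\infty$; 3. for every test function $\phi\in C^1([0,T],C_c(\mathbb{R}_*))$ (where $C_c(\mathbb{R}_*)$ carries the supremum norm) and every $t\in[0,T]$, $$\begin{aligned}\int_{\mathbb{R}_*}\phi(t,x)\,f_t(dx)-\int_{\mathbb{R}_*}\phi(0,x)\,f_0(dx)={}&\int_0^t\int_{\mathbb{R}_*}\partial_s\phi(s,x)\,f_s(dx)\,ds\\&+\frac12\int_0^t\int_{\mathbb{R}_*}\int_{\mathbb{R}_*}\big(\phi(s,x+y)-\phi(s,x)-\phi(s,y)\big)K(x,y)\,f_s(dx)\,f_s(dy)\,ds\\&+\int_0^t\int_{\mathbb{R}_*}\phi(s,x)\,\eta(dx)\,ds,\end{aligned}$$ where the double integral converges absolutely for every $s\in[0,T]$ and is an integrable function of $s\in[0,T]$.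 -/

import Mathlib

open MeasureTheory Set
open scoped ENNReal ZeroAtInfty

noncomputable section

namespace Coagulation

/-- The space `(0, ∞)` of particle sizes, with its usual topology, Borel sets and addition.
A finite Borel measure on it is automatically Radon. -/
abbrev PosReal : Type := {x : ℝ // 0 < x}

/-- Regularity of the coagulation kernel: continuity, and two-sided bounds by a multiple of
`x ^ (γ + lam) * y ^ (-lam) + x ^ (-lam) * y ^ (γ + lam)`. The lower bound makes `K` nonnegative.
Symmetry of `K` is not assumed. -/
structure KernelRegularity (γ lam : ℝ) (K : PosReal → PosReal → ℝ) : Prop where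
  continuous : Continuous (Function.uncurry K)
  bounds : ∃ c₁ c₂ : ℝ, 0 < c₁ ∧ c₁ ≤ c₂ ∧ ∀ x y : PosReal,
    c₁ * ((x : ℝ) ^ (γ + lam) * (y : ℝ) ^ (-lam) + (x : ℝ) ^ (-lam) * (y : ℝ) ^ (γ + lam)) ≤ K x y ∧
    K x y ≤
      c₂ * ((x : ℝ) ^ (γ + lam) * (y : ℝ) ^ (-lam) + (x : ℝ) ^ (-lam) * (y : ℝ) ^ (γ + lam))

/-- The moment `M_p(μ) = ∫ x ^ p μ(dx)`, with values in `[0, ∞]`. -/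
def moment (p : ℝ) (μ : Measure PosReal) : ℝ≥0∞ :=
  ∫⁻ x : PosReal, ENNReal.ofReal ((x : ℝ) ^ p) ∂μ

/-- Continuity on `[0, T]` of a path of positive bounded Radon measures on `(0, ∞)`, for the
weak-* topology (bounded Radon measures being the dual of `C₀((0, ∞))`). -/
def WeakStarContinuousOn (T : ℝ) (f : ℝ → FiniteMeasure PosReal) : Prop :=
  ∀ ψ : C₀(PosReal, ℝ),
    ContinuousOn (fun t : ℝ => ∫ x, ψ x ∂(f t : Measure PosReal)) (Icc 0 T)

/-- The time derivative `∂ₜφ(t, ·)` on `[0, T]` (one-sided at the end points), taken for the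
supremum norm. -/
def timeDeriv (T : ℝ) (φ : ℝ → C₀(PosReal, ℝ)) (t : ℝ) : C₀(PosReal, ℝ) :=
  derivWithin φ (Icc 0 T) t

/-- Test functions `φ ∈ C¹([0, T], C_c((0, ∞)))`: continuously differentiable in time for the
supremum norm, with `φ(t, ·)` and `∂ₜφ(t, ·)` compactly supported at each time. It is not
required that one compact set carries `φ(t, ·)` for all `t`; functions for which there is one
are included. -/
structure IsTestFunction (T : ℝ) (φ : ℝ → C₀(PosReal, ℝ)) : Prop where
  contDiffOn : ContDiffOn ℝ 1 φ (Icc 0 T)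
  hasCompactSupport : ∀ t ∈ Icc (0 : ℝ) T, HasCompactSupport (φ t)
  hasCompactSupport_deriv : ∀ t ∈ Icc (0 : ℝ) T, HasCompactSupport (timeDeriv T φ t)

/-- `(φ(x + y) - φ(x) - φ(y)) K(x, y)`, as a function of the pair `(x, y)`. -/
def coagIntegrand (K : PosReal → PosReal → ℝ) (φ : PosReal → ℝ) (p : PosReal × PosReal) : ℝ :=
  (φ (p.1 + p.2) - φ p.1 - φ p.2) * K p.1 p.2

/-- The weak coagulation operator
`(1/2) ∬ (φ(x + y) - φ(x) - φ(y)) K(x, y) μ(dx) μ(dy)`. -/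
def coagWeak (K : PosReal → PosReal → ℝ) (φ : PosReal → ℝ) (μ : Measure PosReal) : ℝ :=
  (1 / 2 : ℝ) * ∫ p, coagIntegrand K φ p ∂(μ.prod μ)

/-- `f ∈ C([0, T], bounded measures)` is a weak solution on `[0, T]`, supported in `[a, ∞)`, of
the coagulation equation with kernel `K`, source `η` and initial datum `f₀`. The values of `f`
outside `[0, T]` are irrelevant. The two integrability fields say that the coagulation term in
the weak equation is a genuine integral; all other integrands there are bounded. -/
structure IsWeakSolution (γ lam : ℝ) (K : PosReal → PosReal → ℝ) (T : ℝ) (a : PosReal)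
    (f₀ η : FiniteMeasure PosReal) (f : ℝ → FiniteMeasure PosReal) : Prop where
  continuousOn : WeakStarContinuousOn T f
  support_subset : ∀ t ∈ Icc (0 : ℝ) T, (f t : Measure PosReal).support ⊆ Ici a
  sup_moment_one : ⨆ t ∈ Icc (0 : ℝ) T, moment 1 (f t : Measure PosReal) < ∞
  moment_neg_lam : ∫⁻ t in Icc (0 : ℝ) T, moment (-lam) (f t : Measure PosReal) < ∞
  moment_gamma_add_lam : ∫⁻ t in Icc (0 : ℝ) T, moment (γ + lam) (f t : Measure PosReal) < ∞
  integrable_coag : ∀ φ : ℝ → C₀(PosReal, ℝ), IsTestFunction T φ → ∀ s ∈ Icc (0 : ℝ) T,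
    Integrable (coagIntegrand K (φ s))
      ((f s : Measure PosReal).prod (f s : Measure PosReal))
  intervalIntegrable_coag : ∀ φ : ℝ → C₀(PosReal, ℝ), IsTestFunction T φ →
    IntervalIntegrable (fun s => coagWeak K (φ s) (f s : Measure PosReal)) volume 0 T
  weak_eq : ∀ φ : ℝ → C₀(PosReal, ℝ), IsTestFunction T φ → ∀ t ∈ Icc (0 : ℝ) T,
    ∫ x, φ t x ∂(f t : Measure PosReal) - ∫ x, φ 0 x ∂(f₀ : Measure PosReal)
      = (∫ s in (0 : ℝ)..t, ∫ x, timeDeriv T φ s x ∂(f s : Measure PosReal))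
        + (∫ s in (0 : ℝ)..t, coagWeak K (φ s) (f s : Measure PosReal))
        + ∫ s in (0 : ℝ)..t, ∫ x, φ s x ∂(η : Measure PosReal)

end Coagulation

end

/-! For sizes at least `a`, the exponents `γ + lam` and `-lam` can both be raised to a common `θ ∈
[0, 1)` at the cost of a constant, so `K x y ≤ C (x y) ^ θ`. Hence for every `ε > 0` there is `m`
with `K x y ≤ m + ε x y`, and this is all that the construction uses of the power bounds
(`KernelRegularity.sublinearKernel`).

The controlling quantity is the first moment: coalescence conserves it and the source adds at most
`T * Mη`. On `[a, ∞)` it bounds the mass and the tails, so the measures with first moment at most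
`M` form a weakly compact metrizable set (`isCompact_boundedMoment`,
`metrizableSpace_boundedMoment`). Since `∬ x y ≤ M ^ 2`, the part of `K` above level `m` contributes
at most `3 / 2 * ε * M ^ 2 * ‖φ‖` to the coagulation term. The quadratic operator is therefore
weakly continuous on that set although `K` is unbounded (`tendsto_coagWeak`).

Solutions are limits of explicit Euler paths for the symmetrized kernel truncated at height `n`,
with steps so short that the measures stay positive (`exists_eulerPath`). Tested against bounded
functions, these paths are uniformly Lipschitz up to the step size, so a subsequence converges at
every time (`exists_subseq_path`), and dominated convergence yields the integral equation
(`exists_integral_solution`). Some first moment may escape to infinity in the limit, but its upper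
bound survives. A product rule then extends the equation to time-dependent test functions
(`hasDerivAt_integral`). -/

noncomputable section

namespace Coagulation

open Filter Topology
open scoped NNReal BoundedContinuousFunction

/-! ### Weak continuity of the product measure -/

/-- Squaring a finite measure is weakly continuous. -/
theorem tendsto_finiteMeasure_prod_self {ι E : Type*} [MeasurableSpace E] [TopologicalSpace E]
    [SecondCountableTopology E] [TopologicalSpace.PseudoMetrizableSpace E] [BorelSpace E]
    {l : Filter ι} {μs : ι → FiniteMeasure E} {μ : FiniteMeasure E} (h : Tendsto μs l (𝓝 μ)) :
    Tendsto (fun i => (μs i).prod (μs i)) l (𝓝 (μ.prod μ)) := by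
  have hm : Tendsto (fun i => (μs i).mass) l (𝓝 μ.mass) := h.mass
  -- Normalization is continuous only away from the zero measure; at zero, convergence of the masses
  -- suffices.
  rcases eq_or_ne μ 0 with rfl | h0
  · rw [FiniteMeasure.zero_prod]
    apply FiniteMeasure.tendsto_zero_of_tendsto_zero_mass
    simpa [FiniteMeasure.mass_prod] using hm.mul hm
  · have : Nonempty E := by
      by_contra hE
      rw [not_nonempty_iff] at hE
      exact h0 (FiniteMeasure.eq_of_forall_apply_eq _ _ fun s _ => by
        simp [Set.eq_empty_of_isEmpty s])
    have key : ∀ ν : FiniteMeasure E, ν.prod ν =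
        (ν.mass * ν.mass) • (ν.normalize.prod ν.normalize).toFiniteMeasure := by
      intro ν
      apply Subtype.ext
      change (ν : Measure E).prod (ν : Measure E) = (ν.mass * ν.mass) •
        ((ν.normalize : Measure E).prod (ν.normalize : Measure E))
      have := congrArg (fun ρ : FiniteMeasure E => (ρ : Measure E)) ν.self_eq_mass_smul_normalize
      have h2 : (ν : Measure E) = ν.mass • (ν.normalize : Measure E) := this
      conv_lhs => rw [h2]
      rw [Measure.prod_smul_left, Measure.prod_smul_right, smul_smul]
    rw [key μ]
    simp_rw [key]
    have hn : Tendsto (fun i => (μs i).normalize) l (𝓝 μ.normalize) :=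
      FiniteMeasure.tendsto_normalize_of_tendsto h h0
    refine (hm.mul hm).smul ?_
    refine (ProbabilityMeasure.toFiniteMeasure_continuous.tendsto _).comp ?_
    exact (ProbabilityMeasure.continuous_prod.tendsto (μ.normalize, μ.normalize)).comp
      (hn.prodMk_nhds hn)

/-! ### Compactness and metrizability under a first moment bound -/

/-- Finite measures on `[a, ∞)` with first moment at most `M`. -/
def boundedMoment (a : PosReal) (M : ℝ≥0) : Set (FiniteMeasure PosReal) :=
  {μ | (∀ᵐ x ∂(μ : Measure PosReal), a ≤ x) ∧
    ∫⁻ x : PosReal, ENNReal.ofReal (x : ℝ) ∂(μ : Measure PosReal) ≤ M}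

theorem measurable_val : Measurable (fun x : PosReal => (x : ℝ)) := measurable_subtype_coe

theorem boundedMoment.integrable {a : PosReal} {M : ℝ≥0} {μ : FiniteMeasure PosReal}
    (hμ : μ ∈ boundedMoment a M) : Integrable (fun x : PosReal => (x : ℝ)) (μ : Measure PosReal) := by
  refine ⟨measurable_val.aestronglyMeasurable, ?_⟩
  rw [hasFiniteIntegral_iff_ofReal (Eventually.of_forall fun x => x.2.le)]
  exact hμ.2.trans_lt ENNReal.coe_lt_top

theorem boundedMoment.integral_le {a : PosReal} {M : ℝ≥0} {μ : FiniteMeasure PosReal}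
    (hμ : μ ∈ boundedMoment a M) : ∫ x : PosReal, (x : ℝ) ∂(μ : Measure PosReal) ≤ M := by
  rw [integral_eq_lintegral_of_nonneg_ae (Eventually.of_forall fun x => x.2.le)
    measurable_val.aestronglyMeasurable]
  exact ENNReal.toReal_le_of_le_ofReal M.2 (by simpa using hμ.2)

theorem mem_boundedMoment_of_integral_le {a : PosReal} {M : ℝ≥0} {μ : FiniteMeasure PosReal}
    (h1 : ∀ᵐ x ∂(μ : Measure PosReal), a ≤ x)
    (h2 : Integrable (fun x : PosReal => (x : ℝ)) (μ : Measure PosReal))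
    (h3 : ∫ x : PosReal, (x : ℝ) ∂(μ : Measure PosReal) ≤ M) : μ ∈ boundedMoment a M := by
  refine ⟨h1, ?_⟩
  rw [← ofReal_integral_eq_lintegral_ofReal h2 (Eventually.of_forall fun x => x.2.le)]
  simpa using ENNReal.ofReal_le_ofReal h3

theorem boundedMoment.real_univ_le {a : PosReal} {M : ℝ≥0} {μ : FiniteMeasure PosReal}
    (hμ : μ ∈ boundedMoment a M) : (μ : Measure PosReal).real univ ≤ M / a := by
  rw [le_div_iff₀ a.2]
  have : ∫ _ : PosReal, (a : ℝ) ∂(μ : Measure PosReal) ≤ ∫ x : PosReal, (x : ℝ) ∂(μ : Measure PosReal) :=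
    integral_mono_ae (integrable_const _) (boundedMoment.integrable hμ) hμ.1
  rw [integral_const, smul_eq_mul] at this
  exact this.trans (boundedMoment.integral_le hμ)

/-- Markov's inequality for the tails. -/
theorem boundedMoment.measure_gt_le {a : PosReal} {M : ℝ≥0} {μ : FiniteMeasure PosReal}
    (hμ : μ ∈ boundedMoment a M) (n : ℕ) :
    μ (Subtype.val ⁻¹' (Icc (a : ℝ) (n + 1)))ᶜ ≤ M / (n + 1) := by
  rw [← ENNReal.coe_le_coe, FiniteMeasure.ennreal_coeFn_eq_coeFn_toMeasure]
  have h1 : (μ : Measure PosReal) (Subtype.val ⁻¹' (Icc (a : ℝ) (n + 1)))ᶜ ≤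
      (μ : Measure PosReal) {x | ENNReal.ofReal (n + 1) ≤ ENNReal.ofReal (x : ℝ)} := by
    apply measure_mono_ae
    filter_upwards [hμ.1] with x hx hx2
    refine ENNReal.ofReal_le_ofReal ?_
    by_contra! h
    exact hx2 ⟨hx, h.le⟩
  refine h1.trans ((meas_ge_le_lintegral_div measurable_val.ennreal_ofReal.aemeasurable
    (by simp; positivity) ENNReal.ofReal_ne_top).trans ?_)
  rw [ENNReal.coe_div (by positivity)]
  refine ENNReal.div_le_div hμ.2 ?_
  rw [ENNReal.ofReal_add (by positivity) zero_le_one]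
  simp

theorem isCompact_preimage_val_Icc (a : PosReal) (b : ℝ) :
    IsCompact ((Subtype.val : PosReal → ℝ) ⁻¹' Icc (a : ℝ) b) := by
  rw [Subtype.isCompact_iff]
  convert isCompact_Icc (a := (a : ℝ)) (b := b) using 1
  ext x
  exact ⟨fun ⟨y, hy, hyx⟩ => hyx ▸ hy, fun hx => ⟨⟨x, a.2.trans_le hx.1⟩, hx, rfl⟩⟩

/-- The function `min x R` as a bounded continuous function. -/
def truncVal (R : ℝ≥0) : PosReal →ᵇ ℝ≥0 :=
  BoundedContinuousFunction.mkOfBound ⟨fun x => min (Real.toNNReal x) R, by fun_prop⟩ R (by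
    intro x y
    rw [NNReal.dist_eq, abs_sub_le_iff]
    have h1 : ((min (Real.toNNReal x) R : ℝ≥0) : ℝ) ≤ R := by exact_mod_cast min_le_right _ _
    have h2 : ((min (Real.toNNReal y) R : ℝ≥0) : ℝ) ≤ R := by exact_mod_cast min_le_right _ _
    have h3 := (min (Real.toNNReal x) R).2
    have h4 := (min (Real.toNNReal y) R).2
    constructor <;> simp only [ContinuousMap.coe_mk] <;> linarith)

/-- The function `(a - x)⁺` as a bounded continuous function. -/
def belowVal (a : PosReal) : PosReal →ᵇ ℝ≥0 :=
  BoundedContinuousFunction.mkOfBound ⟨fun x => Real.toNNReal (a - x), by fun_prop⟩ a (by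
    intro x y
    rw [NNReal.dist_eq, abs_sub_le_iff]
    simp only [ContinuousMap.coe_mk, Real.coe_toNNReal']
    have := x.2; have := y.2; have := a.2
    constructor
    · have : max ((a : ℝ) - x) 0 ≤ a := by simp [this.le, x.2.le]
      have := le_max_right ((a : ℝ) - y) 0
      linarith
    · have : max ((a : ℝ) - y) 0 ≤ a := by simp [this.le, y.2.le]
      have := le_max_right ((a : ℝ) - x) 0
      linarith)

/-- Both conditions become constraints on integrals of bounded continuous functions, which are
closed conditions: the support is detected by `(a - x)⁺`, and the unbounded weight `x` is the
supremum of `min x n`. -/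
theorem boundedMoment_eq (a : PosReal) (M : ℝ≥0) : boundedMoment a M =
    {μ : FiniteMeasure PosReal | ∫⁻ x, belowVal a x ∂(μ : Measure PosReal) = 0} ∩
    ⋂ n : ℕ, {μ : FiniteMeasure PosReal | ∫⁻ x, truncVal n x ∂(μ : Measure PosReal) ≤ M} := by
  ext μ
  simp only [boundedMoment, mem_ofPred_eq, mem_inter_iff, mem_iInter]
  refine and_congr ?_ ?_
  · rw [lintegral_eq_zero_iff (by fun_prop)]
    refine eventually_congr (Eventually.of_forall fun x => ?_)
    simp [belowVal, BoundedContinuousFunction.mkOfBound]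
  · constructor
    · intro h n
      refine (lintegral_mono fun x => ?_).trans h
      change ((min (Real.toNNReal x) n : ℝ≥0) : ℝ≥0∞) ≤ Real.toNNReal x
      exact_mod_cast min_le_left _ _
    · intro h
      have : ∀ x : PosReal, ENNReal.ofReal (x : ℝ) = ⨆ n : ℕ, (truncVal n x : ℝ≥0∞) := by
        intro x
        apply le_antisymm
        · obtain ⟨n, hn⟩ := exists_nat_ge (Real.toNNReal x)
          refine le_iSup_of_le n ?_
          change (Real.toNNReal x : ℝ≥0∞) ≤ ((min (Real.toNNReal x) n : ℝ≥0) : ℝ≥0∞)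
          rw [min_eq_left hn]
        · refine iSup_le fun n => ?_
          change ((min (Real.toNNReal x) n : ℝ≥0) : ℝ≥0∞) ≤ Real.toNNReal x
          exact_mod_cast min_le_left _ _
      simp_rw [this]
      rw [lintegral_iSup (fun n => by fun_prop)]
      · exact iSup_le h
      · intro n m hnm x
        change ((min (Real.toNNReal x) n : ℝ≥0) : ℝ≥0∞) ≤ ((min (Real.toNNReal x) m : ℝ≥0) : ℝ≥0∞)
        have : (n : ℝ≥0) ≤ m := by exact_mod_cast hnm
        exact_mod_cast min_le_min_left _ this

theorem isClosed_boundedMoment (a : PosReal) (M : ℝ≥0) : IsClosed (boundedMoment a M) := by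
  rw [boundedMoment_eq]
  refine (isClosed_eq ?_ continuous_const).inter (isClosed_iInter fun n => isClosed_le ?_
    continuous_const) <;>
  exact FiniteMeasure.continuous_lintegral_boundedContinuousFunction _

/-- Prokhorov's criterion: masses are at most `M / a`, and the mass outside the compact set `[a, n +
1]` is at most `M / (n + 1)`. -/
theorem isCompact_boundedMoment (a : PosReal) (M : ℝ≥0) : IsCompact (boundedMoment a M) := by
  refine (isCompact_setOfPred_finiteMeasure_mass_le_compl_isCompact_le (E := PosReal)
    (u := fun n => M / (n + 1)) (K := fun n => Subtype.val ⁻¹' (Icc (a : ℝ) (n + 1)))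
    (M / Real.toNNReal a) ?_ (fun n => isCompact_preimage_val_Icc a _)
    (Or.inl inferInstance)).of_isClosed_subset (isClosed_boundedMoment a M) ?_
  · rw [← NNReal.tendsto_coe]
    simpa using (tendsto_one_div_add_atTop_nhds_zero_nat (𝕜 := ℝ)).const_mul (M : ℝ) 
      |>.congr fun n => by rw [mul_one_div]
  · intro μ hμ
    refine ⟨?_, fun n => boundedMoment.measure_gt_le hμ n⟩
    have := boundedMoment.real_univ_le hμ
    rw [← NNReal.coe_le_coe, NNReal.coe_div, Real.coe_toNNReal _ a.2.le]
    simpa using this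

/-- The functions `x ↦ exp (i t x)` on `(0, ∞)`. -/
def expChar (t : ℝ) : PosReal →ᵇ ℂ :=
  BoundedContinuousFunction.ofNormedAddCommGroup
    (fun x => Complex.exp ((t * x : ℝ) * Complex.I)) (by fun_prop) 1
    (fun x => by rw [Complex.norm_exp_ofReal_mul_I])

theorem charFun_map_val (μ : FiniteMeasure PosReal) (t : ℝ) :
    charFun ((μ : Measure PosReal).map Subtype.val) t = ∫ x, expChar t x ∂(μ : Measure PosReal) := by
  rw [charFun_apply_real, integral_map measurable_val.aemeasurable (by fun_prop)]
  simp [expChar]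

theorem eq_of_integral_expChar_eq {μ ν : FiniteMeasure PosReal}
    (h : ∀ q : ℚ, ∫ x, expChar q x ∂(μ : Measure PosReal) = ∫ x, expChar q x ∂(ν : Measure PosReal)) :
    μ = ν := by
  have h2 : charFun ((μ : Measure PosReal).map Subtype.val) =
      charFun ((ν : Measure PosReal).map Subtype.val) := by
    refine Continuous.ext_on Rat.denseRange_cast continuous_charFun continuous_charFun ?_
    rintro _ ⟨q, rfl⟩
    rw [charFun_map_val, charFun_map_val, h]
  have h3 := Measure.ext_of_charFun h2
  apply Subtype.ext
  exact (MeasurableEmbedding.subtype_coe measurableSet_Ioi).map_injective h3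

/-- Countably many continuous functionals, the characters at rational frequencies, separate
measures, so the compact set embeds in `ℚ → ℂ`. Metrizability is what allows extraction of
subsequences. -/
theorem metrizableSpace_boundedMoment (a : PosReal) (M : ℝ≥0) :
    TopologicalSpace.MetrizableSpace (boundedMoment a M) := by
  have : CompactSpace (boundedMoment a M) :=
    isCompact_iff_compactSpace.mp (isCompact_boundedMoment a M)
  let F : boundedMoment a M → ℚ → ℂ := fun μ q => ∫ x, expChar q x ∂(μ.1 : Measure PosReal)
  have hF : Continuous F := by
    refine continuous_pi fun q => ?_
    have : Continuous fun μ : FiniteMeasure PosReal => ∫ x, expChar q x ∂(μ : Measure PosReal) :=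
      continuous_iff_continuousAt.2 fun μ =>
        (FiniteMeasure.tendsto_iff_forall_integral_rclike_tendsto ℂ).1 tendsto_id _
    exact this.comp continuous_subtype_val
  have hinj : Function.Injective F := fun μ ν h =>
    Subtype.ext (eq_of_integral_expChar_eq fun q => congrFun h q)
  exact (hF.isClosedEmbedding hinj).isEmbedding.metrizableSpace

/-! ### The coagulation operator under a first moment bound -/

section

theorem continuous_add_posReal : Continuous (fun p : PosReal × PosReal => p.1 + p.2) :=
  Continuous.subtype_mk ((continuous_subtype_val.comp continuous_fst).add
    (continuous_subtype_val.comp continuous_snd)) _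

theorem continuous_coagIntegrand {K : PosReal → PosReal → ℝ} (hK : Continuous (Function.uncurry K))
    {φ : PosReal → ℝ} (hφ : Continuous φ) : Continuous (coagIntegrand K φ) :=
  (((hφ.comp continuous_add_posReal).sub (hφ.comp continuous_fst)).sub
    (hφ.comp continuous_snd)).mul hK

theorem abs_coagIntegrand_le (K : PosReal → PosReal → ℝ) (φ : PosReal →ᵇ ℝ)
    (p : PosReal × PosReal) : |coagIntegrand K φ p| ≤ 3 * ‖φ‖ * |K p.1 p.2| := by
  rw [coagIntegrand, abs_mul]
  refine mul_le_mul_of_nonneg_right ?_ (abs_nonneg _)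
  have h1 := φ.norm_coe_le_norm (p.1 + p.2)
  have h2 := φ.norm_coe_le_norm p.1
  have h3 := φ.norm_coe_le_norm p.2
  rw [Real.norm_eq_abs, abs_le] at h1 h2 h3
  rw [abs_le]
  constructor <;> linarith

theorem ae_le_prod {a : PosReal} {μ : Measure PosReal} [IsFiniteMeasure μ] (h : ∀ᵐ x ∂μ, a ≤ x) :
    ∀ᵐ p ∂(μ.prod μ), a ≤ p.1 ∧ a ≤ p.2 :=
  (Measure.quasiMeasurePreserving_fst.ae h).and (Measure.quasiMeasurePreserving_snd.ae h)

variable {a : PosReal} {M : ℝ≥0} {K : PosReal → PosReal → ℝ}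

theorem boundedMoment.integrable_mul {μ : FiniteMeasure PosReal} (hμ : μ ∈ boundedMoment a M) :
    Integrable (fun p : PosReal × PosReal => (p.1 : ℝ) * p.2)
      ((μ : Measure PosReal).prod (μ : Measure PosReal)) :=
  (boundedMoment.integrable hμ).mul_prod (boundedMoment.integrable hμ)

theorem integrable_coagIntegrand {A : ℝ} (hK : Continuous (Function.uncurry K))
    (hA : ∀ x y, a ≤ x → a ≤ y → |K x y| ≤ A * (x * y)) {μ : FiniteMeasure PosReal}
    (hμ : μ ∈ boundedMoment a M) (φ : PosReal →ᵇ ℝ) :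
    Integrable (coagIntegrand K φ) ((μ : Measure PosReal).prod (μ : Measure PosReal)) := by
  refine ((boundedMoment.integrable_mul hμ).const_mul (3 * ‖φ‖ * A)).mono'
    (continuous_coagIntegrand hK φ.continuous).aestronglyMeasurable ?_
  filter_upwards [ae_le_prod hμ.1] with p hp
  refine (abs_coagIntegrand_le K φ p).trans ?_
  rw [mul_assoc (3 * ‖φ‖)]
  exact mul_le_mul_of_nonneg_left (hA _ _ hp.1 hp.2) (by positivity)

/-- The three values of `φ` cost `3 * ‖φ‖`, and `∬ x y` is the square of the first moment. Applied
to differences of kernels, the same bound controls truncation errors. -/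
theorem abs_coagWeak_le {A : ℝ} (hA0 : 0 ≤ A)
    (hA : ∀ x y, a ≤ x → a ≤ y → |K x y| ≤ A * (x * y)) {μ : FiniteMeasure PosReal}
    (hμ : μ ∈ boundedMoment a M) (φ : PosReal →ᵇ ℝ) :
    |coagWeak K φ (μ : Measure PosReal)| ≤ 3 / 2 * A * M ^ 2 * ‖φ‖ := by
  have h1 : ‖∫ p, coagIntegrand K φ p ∂((μ : Measure PosReal).prod (μ : Measure PosReal))‖ ≤
      ∫ p : PosReal × PosReal, 3 * ‖φ‖ * A * ((p.1 : ℝ) * p.2)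
        ∂((μ : Measure PosReal).prod (μ : Measure PosReal)) := by
    refine norm_integral_le_of_norm_le ((boundedMoment.integrable_mul hμ).const_mul _) ?_
    filter_upwards [ae_le_prod hμ.1] with p hp
    refine (abs_coagIntegrand_le K φ p).trans ?_
    rw [mul_assoc (3 * ‖φ‖)]
    exact mul_le_mul_of_nonneg_left (hA _ _ hp.1 hp.2) (by positivity)
  rw [integral_const_mul, integral_prod_mul (fun x : PosReal => (x : ℝ)) (fun x : PosReal => (x : ℝ))]
    at h1
  have h2 := boundedMoment.integral_le hμ
  have h3 : 0 ≤ ∫ x : PosReal, (x : ℝ) ∂(μ : Measure PosReal) := integral_nonneg fun x => x.2.le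
  have h4 := mul_le_mul h2 h2 h3 M.2
  rw [coagWeak, abs_mul, abs_of_pos (by norm_num : (0 : ℝ) < 1 / 2)]
  have h5 := mul_le_mul_of_nonneg_left h4 (by positivity : 0 ≤ 3 * ‖φ‖ * A)
  rw [Real.norm_eq_abs] at h1
  nlinarith [h1, h5]

theorem coagWeak_sub_kernel {A₁ A₂ : ℝ} {K₁ K₂ : PosReal → PosReal → ℝ}
    (hK₁ : Continuous (Function.uncurry K₁)) (hK₂ : Continuous (Function.uncurry K₂))
    (hA₁ : ∀ x y, a ≤ x → a ≤ y → |K₁ x y| ≤ A₁ * (x * y))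
    (hA₂ : ∀ x y, a ≤ x → a ≤ y → |K₂ x y| ≤ A₂ * (x * y)) {μ : FiniteMeasure PosReal}
    (hμ : μ ∈ boundedMoment a M) (φ : PosReal →ᵇ ℝ) :
    coagWeak K₁ φ (μ : Measure PosReal) - coagWeak K₂ φ (μ : Measure PosReal) =
      coagWeak (fun x y => K₁ x y - K₂ x y) φ (μ : Measure PosReal) := by
  rw [coagWeak, coagWeak, coagWeak, ← mul_sub, ← integral_sub
    (integrable_coagIntegrand hK₁ hA₁ hμ φ) (integrable_coagIntegrand hK₂ hA₂ hμ φ)]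
  simp only [coagIntegrand, mul_sub]

theorem coagWeak_sub {A : ℝ} (hK : Continuous (Function.uncurry K))
    (hA : ∀ x y, a ≤ x → a ≤ y → |K x y| ≤ A * (x * y)) {μ : FiniteMeasure PosReal}
    (hμ : μ ∈ boundedMoment a M) (φ ψ : PosReal →ᵇ ℝ) :
    coagWeak K φ (μ : Measure PosReal) - coagWeak K ψ (μ : Measure PosReal) =
      coagWeak K (φ - ψ : PosReal →ᵇ ℝ) (μ : Measure PosReal) := by
  rw [coagWeak, coagWeak, coagWeak, ← mul_sub, ← integral_sub
    (integrable_coagIntegrand hK hA hμ φ) (integrable_coagIntegrand hK hA hμ ψ)]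
  congr 2 with p
  simp only [coagIntegrand, BoundedContinuousFunction.coe_sub, Pi.sub_apply]
  ring

/-- Continuous nonnegative kernels which on `[a, ∞)²` are `o (x y)` where they are large. -/
structure SublinearKernel (a : PosReal) (K : PosReal → PosReal → ℝ) : Prop where
  continuous : Continuous (Function.uncurry K)
  nonneg : ∀ x y, 0 ≤ K x y
  sublinear : ∀ ε > 0, ∃ m : ℝ, ∀ x y : PosReal, a ≤ x → a ≤ y → K x y ≤ m + ε * (x * y)

/-- The additive constant is absorbed because `x * y ≥ a * a`. -/
theorem SublinearKernel.exists_le_mul (hK : SublinearKernel a K) :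
    ∃ A : ℝ, 0 ≤ A ∧ ∀ x y : PosReal, a ≤ x → a ≤ y → K x y ≤ A * (x * y) := by
  obtain ⟨m, hm⟩ := hK.sublinear 1 one_pos
  have ha := a.2
  refine ⟨|m| / (a * a) + 1, by positivity, fun x y hx hy => (hm x y hx hy).trans ?_⟩
  have h1 : (a : ℝ) * a ≤ x * y := mul_le_mul hx hy a.2.le x.2.le
  have h2 : |m| ≤ |m| / (a * a) * (x * y) := by
    rw [div_mul_eq_mul_div, le_div_iff₀ (by positivity)]
    exact mul_le_mul_of_nonneg_left h1 (abs_nonneg _)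
  linarith [le_abs_self m]

/-- The truncated kernel `min (K x y) N`. -/
def truncKernel (K : PosReal → PosReal → ℝ) (N : ℝ) (x y : PosReal) : ℝ := min (K x y) N

theorem SublinearKernel.truncKernel (hK : SublinearKernel a K) {N : ℝ} (hN : 0 ≤ N) :
    SublinearKernel a (truncKernel K N) where
  continuous := hK.continuous.min continuous_const
  nonneg x y := le_min (hK.nonneg x y) hN
  sublinear ε hε := (hK.sublinear ε hε).imp fun _ hm x y hx hy =>
    (min_le_left _ _).trans (hm x y hx hy)

/-- The weak coagulation operator of a bounded kernel is weakly continuous. -/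
theorem tendsto_coagWeak_of_bounded {ι : Type*} {l : Filter ι}
    (hK : Continuous (Function.uncurry K)) {N : ℝ} (hN : ∀ x y, |K x y| ≤ N)
    {μs : ι → FiniteMeasure PosReal} {μ : FiniteMeasure PosReal}
    (h : Tendsto μs l (𝓝 μ)) (φ : PosReal →ᵇ ℝ) :
    Tendsto (fun i => coagWeak K φ (μs i : Measure PosReal)) l
      (𝓝 (coagWeak K φ (μ : Measure PosReal))) := by
  let g : (PosReal × PosReal) →ᵇ ℝ := BoundedContinuousFunction.ofNormedAddCommGroup
    (coagIntegrand K φ) (continuous_coagIntegrand hK φ.continuous) (3 * ‖φ‖ * N)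
    (fun p => (abs_coagIntegrand_le K φ p).trans
      (mul_le_mul_of_nonneg_left (hN _ _) (by positivity)))
  exact (FiniteMeasure.tendsto_iff_forall_integral_tendsto.1
    (tendsto_finiteMeasure_prod_self h) g).const_mul _

/-- Weak continuity of the coagulation operator on measures with bounded first moment, with
perturbed kernels `k i` close to `K` up to truncation. -/
theorem tendsto_coagWeak {ι : Type*} {l : Filter ι} (hK : SublinearKernel a K)
    {k : ι → PosReal → PosReal → ℝ} {A : ℝ} (hk : ∀ i, Continuous (Function.uncurry (k i)))
    (hkA : ∀ i x y, a ≤ x → a ≤ y → |k i x y| ≤ A * (x * y))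
    -- Two choices of `k` satisfy this: truncations of `K` at heights tending to infinity, and `K`
    -- itself.
    (hkm : ∀ m ε : ℝ, 0 < ε → (∀ x y : PosReal, a ≤ x → a ≤ y → K x y ≤ m + ε * (x * y)) →
      ∀ᶠ i in l, ∀ x y, a ≤ x → a ≤ y → |k i x y - truncKernel K m x y| ≤ ε * (x * y))
    {μs : ι → FiniteMeasure PosReal} {μ : FiniteMeasure PosReal}
    (hμs : ∀ i, μs i ∈ boundedMoment a M) (hμ : μ ∈ boundedMoment a M)
    (h : Tendsto μs l (𝓝 μ)) (φ : PosReal →ᵇ ℝ) :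
    Tendsto (fun i => coagWeak (k i) φ (μs i : Measure PosReal)) l
      (𝓝 (coagWeak K φ (μ : Measure PosReal))) := by
  rw [Metric.tendsto_nhds]
  intro δ hδ
  -- The error `δ` is split in three: replacing `k i` by the truncation, weak convergence for the
  -- bounded truncated kernel, and returning from the truncation to `K`.
  obtain ⟨ε, hε, hεδ⟩ : ∃ ε > 0, 3 / 2 * ε * (M : ℝ) ^ 2 * ‖φ‖ < δ / 3 := by
    refine ⟨δ / 3 / (3 / 2 * (M : ℝ) ^ 2 * ‖φ‖ + 1), by positivity, ?_⟩
    have : 3 / 2 * (δ / 3 / (3 / 2 * (M : ℝ) ^ 2 * ‖φ‖ + 1)) * (M : ℝ) ^ 2 * ‖φ‖ =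
      (δ / 3) * ((3 / 2 * (M : ℝ) ^ 2 * ‖φ‖) / (3 / 2 * (M : ℝ) ^ 2 * ‖φ‖ + 1)) := by ring
    rw [this]
    refine mul_lt_of_lt_one_right (by positivity) ?_
    rw [div_lt_one (by positivity)]
    linarith
  obtain ⟨m', hm'⟩ := hK.sublinear ε hε
  -- A nonnegative truncation height keeps the truncated kernel nonnegative.
  set m := max m' 0
  have hm : ∀ x y : PosReal, a ≤ x → a ≤ y → K x y ≤ m + ε * (x * y) := fun x y hx hy =>
    (hm' x y hx hy).trans (by gcongr; exact le_max_left _ _)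
  have hm0 : 0 ≤ m := le_max_right _ _
  obtain ⟨B, hB0, hB⟩ := hK.exists_le_mul
  have hB' : ∀ x y : PosReal, a ≤ x → a ≤ y → |K x y| ≤ B * (x * y) := fun x y hx hy => by
    rw [abs_of_nonneg (hK.nonneg x y)]; exact hB x y hx hy
  have hT := hK.truncKernel hm0
  have hTB : ∀ x y : PosReal, a ≤ x → a ≤ y → |truncKernel K m x y| ≤ B * (x * y) :=
    fun x y hx hy => by
      rw [abs_of_nonneg (hT.nonneg x y)]; exact (min_le_left _ _).trans (hB x y hx hy)
  have hTm : ∀ x y, |truncKernel K m x y| ≤ m := fun x y => by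
    rw [abs_of_nonneg (hT.nonneg x y)]; exact min_le_right _ _
  have hKT : ∀ x y : PosReal, a ≤ x → a ≤ y → |truncKernel K m x y - K x y| ≤ ε * (x * y) := by
    intro x y hx hy
    have hx0 := x.2
    have hy0 := y.2
    have h0 : 0 ≤ ε * ((x : ℝ) * y) := by positivity
    rw [abs_sub_comm, abs_of_nonneg (sub_nonneg.2 (min_le_left _ _)), truncKernel, sub_le_iff_le_add,
      ← min_add_add_left]
    exact le_min (by linarith) (by linarith [hm x y hx hy])
  have hfin : |coagWeak (truncKernel K m) φ (μ : Measure PosReal) -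
      coagWeak K φ (μ : Measure PosReal)| < δ / 3 := by
    rw [coagWeak_sub_kernel hT.continuous hK.continuous hTB hB' hμ φ]
    exact (abs_coagWeak_le hε.le hKT hμ φ).trans_lt hεδ
  filter_upwards [hkm m ε hε hm, Metric.tendsto_nhds.1
    (tendsto_coagWeak_of_bounded hT.continuous hTm h φ) (δ / 3) (by positivity)] with i hi1 hi2
  have h1 : |coagWeak (k i) φ (μs i : Measure PosReal) -
      coagWeak (truncKernel K m) φ (μs i : Measure PosReal)| < δ / 3 := by
    rw [coagWeak_sub_kernel (hk i) hT.continuous (hkA i) hTB (hμs i) φ]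
    exact (abs_coagWeak_le hε.le hi1 (hμs i) φ).trans_lt hεδ
  rw [Real.dist_eq] at hi2 ⊢
  rw [abs_lt] at *
  constructor <;> linarith

end

/-! ### The explicit Euler step -/

/-- The coagulation loss rate `∫ k x y μ(dy)` of particles of size `x`. -/
def lossRate (k : PosReal → PosReal → ℝ) (μ : Measure PosReal) (x : PosReal) : ℝ := ∫ y, k x y ∂μ

/-- One step of the explicit Euler scheme for the coagulation equation. -/
def eulerStep (h : ℝ) (k : PosReal → PosReal → ℝ) (η μ : Measure PosReal) : Measure PosReal :=
  μ.withDensity (fun x => ENNReal.ofReal (1 - h * lossRate k μ x)) +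
    (ENNReal.ofReal (h / 2) • ((μ.prod μ).withDensity
      (fun p => ENNReal.ofReal (k p.1 p.2))).map (fun p => p.1 + p.2) + ENNReal.ofReal h • η)

theorem integral_withDensity_ofReal {X : Type*} [MeasurableSpace X] {μ : Measure X} {d : X → ℝ}
    (hd : Measurable d) (hd0 : ∀ x, 0 ≤ d x) (φ : X → ℝ) :
    ∫ x, φ x ∂(μ.withDensity fun x => ENNReal.ofReal (d x)) = ∫ x, d x * φ x ∂μ := by
  rw [integral_withDensity_eq_integral_toReal_smul hd.ennreal_ofReal (by simp)]
  simp [ENNReal.toReal_ofReal (hd0 _)]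

theorem integrable_withDensity_ofReal {X : Type*} [MeasurableSpace X] {μ : Measure X} {d : X → ℝ}
    (hd : Measurable d) (hd0 : ∀ x, 0 ≤ d x) {φ : X → ℝ} (h : Integrable (fun x => d x * φ x) μ) :
    Integrable φ (μ.withDensity fun x => ENNReal.ofReal (d x)) := by
  rw [integrable_withDensity_iff_integrable_smul' hd.ennreal_ofReal (by simp)]
  simpa [ENNReal.toReal_ofReal (hd0 _)] using h

section

variable {k : PosReal → PosReal → ℝ} {N h : ℝ} {μ η : Measure PosReal}

theorem integrable_kernel_mul (hk : Continuous (Function.uncurry k))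
    (hk0 : ∀ x y, 0 ≤ k x y) (hkN : ∀ x y, k x y ≤ N) {F : PosReal × PosReal → ℝ}
    (hF : Integrable F (μ.prod μ)) : Integrable (fun p => k p.1 p.2 * F p) (μ.prod μ) := by
  refine hF.bdd_mul (c := N) hk.aestronglyMeasurable (Eventually.of_forall fun p => ?_)
  rw [Real.norm_eq_abs]
  exact (abs_of_nonneg (hk0 p.1 p.2)).trans_le (hkN p.1 p.2)

theorem lossRate_nonneg (hk0 : ∀ x y, 0 ≤ k x y) (x : PosReal) : 0 ≤ lossRate k μ x :=
  integral_nonneg fun y => hk0 x y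

variable [IsFiniteMeasure μ]

theorem measurable_lossRate (hk : Continuous (Function.uncurry k)) : Measurable (lossRate k μ) :=
  (hk.measurable.stronglyMeasurable.integral_prod_right).measurable

theorem lossRate_le (hk0 : ∀ x y, 0 ≤ k x y) (hkN : ∀ x y, k x y ≤ N) (x : PosReal) :
    lossRate k μ x ≤ N * μ.real univ := by
  have := integral_mono_of_nonneg (μ := μ) (Eventually.of_forall fun y => hk0 x y)
    (integrable_const N) (Eventually.of_forall fun y => hkN x y)
  rw [integral_const, smul_eq_mul, mul_comm] at this
  exact this

theorem integrable_lossRate_mul (hk : Continuous (Function.uncurry k)) (hk0 : ∀ x y, 0 ≤ k x y)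
    (hkN : ∀ x y, k x y ≤ N) {φ : PosReal → ℝ} (hφ : Integrable φ μ) :
    Integrable (fun x => lossRate k μ x * φ x) μ := by
  refine hφ.bdd_mul (c := N * μ.real univ) (measurable_lossRate hk).aestronglyMeasurable
    (Eventually.of_forall fun x => ?_)
  rw [Real.norm_eq_abs, abs_of_nonneg (lossRate_nonneg hk0 x)]
  exact lossRate_le hk0 hkN x

theorem integral_lossRate_mul (hk : Continuous (Function.uncurry k)) (hk0 : ∀ x y, 0 ≤ k x y)
    (hkN : ∀ x y, k x y ≤ N) {φ : PosReal → ℝ} (hφ : Integrable φ μ) :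
    ∫ x, lossRate k μ x * φ x ∂μ = ∫ p, k p.1 p.2 * φ p.1 ∂(μ.prod μ) := by
  rw [integral_prod _ (integrable_kernel_mul hk hk0 hkN (hφ.comp_fst μ))]
  simp only [lossRate, integral_mul_const]

theorem integrable_add_eulerStep (hk : Continuous (Function.uncurry k)) (hk0 : ∀ x y, 0 ≤ k x y)
    (hkN : ∀ x y, k x y ≤ N) (hh : ∀ x, h * lossRate k μ x ≤ 1) {φ : PosReal → ℝ}
    (hm : Measurable φ) (hφ : Integrable φ μ) (hφη : Integrable φ η)
    (hφ2 : Integrable (fun p : PosReal × PosReal => φ (p.1 + p.2)) (μ.prod μ)) :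
    Integrable φ (μ.withDensity (fun x => ENNReal.ofReal (1 - h * lossRate k μ x))) ∧
    Integrable φ (ENNReal.ofReal (h / 2) • ((μ.prod μ).withDensity
      (fun p => ENNReal.ofReal (k p.1 p.2))).map (fun p => p.1 + p.2)) ∧
    Integrable φ (ENNReal.ofReal h • η) := by
  refine ⟨?_, ?_, hφη.smul_measure ENNReal.ofReal_ne_top⟩
  · refine integrable_withDensity_ofReal (measurable_const.sub ((measurable_lossRate hk).const_mul h))
      (fun x => sub_nonneg.2 (hh x)) ?_
    convert hφ.sub ((integrable_lossRate_mul hk hk0 hkN hφ).const_mul h) using 1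
    ext x
    simp only [Pi.sub_apply]
    ring
  · refine Integrable.smul_measure ?_ ENNReal.ofReal_ne_top
    rw [integrable_map_measure hm.aestronglyMeasurable continuous_add_posReal.measurable.aemeasurable]
    exact integrable_withDensity_ofReal hk.measurable (fun p => hk0 p.1 p.2)
      (integrable_kernel_mul hk hk0 hkN hφ2)

theorem integrable_eulerStep (hk : Continuous (Function.uncurry k)) (hk0 : ∀ x y, 0 ≤ k x y)
    (hkN : ∀ x y, k x y ≤ N) (hh : ∀ x, h * lossRate k μ x ≤ 1) {φ : PosReal → ℝ}
    (hm : Measurable φ) (hφ : Integrable φ μ) (hφη : Integrable φ η)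
    (hφ2 : Integrable (fun p : PosReal × PosReal => φ (p.1 + p.2)) (μ.prod μ)) :
    Integrable φ (eulerStep h k η μ) := by
  obtain ⟨h1, h2, h3⟩ := integrable_add_eulerStep hk hk0 hkN hh hm hφ hφη hφ2
  exact h1.add_measure (h2.add_measure h3)

/-- The Euler step tested against a function. -/
theorem integral_eulerStep (hk : Continuous (Function.uncurry k)) (hk0 : ∀ x y, 0 ≤ k x y)
    (hkN : ∀ x y, k x y ≤ N) (hsymm : ∀ x y, k x y = k y x) (h0 : 0 ≤ h)
    (hh : ∀ x, h * lossRate k μ x ≤ 1) {φ : PosReal → ℝ}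
    (hm : Measurable φ) (hφ : Integrable φ μ) (hφη : Integrable φ η)
    (hφ2 : Integrable (fun p : PosReal × PosReal => φ (p.1 + p.2)) (μ.prod μ)) :
    ∫ x, φ x ∂(eulerStep h k η μ) = ∫ x, φ x ∂μ + h * (coagWeak k φ μ + ∫ x, φ x ∂η) := by
  obtain ⟨h1, h2, h3⟩ := integrable_add_eulerStep hk hk0 hkN hh hm hφ hφη hφ2
  rw [eulerStep, integral_add_measure h1 (h2.add_measure h3), integral_add_measure h2 h3,
    integral_smul_measure, integral_smul_measure, ENNReal.toReal_ofReal (by positivity),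
    ENNReal.toReal_ofReal h0, integral_map continuous_add_posReal.measurable.aemeasurable
      hm.aestronglyMeasurable, integral_withDensity_ofReal (d := fun p : PosReal × PosReal => k p.1 p.2) hk.measurable
      (fun p => hk0 p.1 p.2),
    integral_withDensity_ofReal (d := fun x => 1 - h * lossRate k μ x)
      (measurable_const.sub ((measurable_lossRate hk).const_mul h))
      (fun x => sub_nonneg.2 (hh x))]
  have e1 : ∫ x, (1 - h * lossRate k μ x) * φ x ∂μ =
      ∫ x, φ x ∂μ - h * ∫ p, k p.1 p.2 * φ p.1 ∂(μ.prod μ) := by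
    rw [← integral_lossRate_mul hk hk0 hkN hφ, ← integral_const_mul, ← integral_sub hφ
      ((integrable_lossRate_mul hk hk0 hkN hφ).const_mul h)]
    congr 1 with x
    ring
  have i1 := integrable_kernel_mul hk hk0 hkN hφ2
  have i2 := integrable_kernel_mul hk hk0 hkN (hφ.comp_fst μ)
  have i3 := integrable_kernel_mul hk hk0 hkN (hφ.comp_snd μ)
  -- By symmetry of `k` the losses of the two partners agree, so the full loss rate in the step
  -- matches the half-weighted pair of losses in `coagWeak`.
  have e2 : ∫ p, k p.1 p.2 * φ p.2 ∂(μ.prod μ) = ∫ p, k p.1 p.2 * φ p.1 ∂(μ.prod μ) := by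
    rw [← integral_prod_swap]
    congr 1 with p
    simp only [Prod.fst_swap, Prod.snd_swap, hsymm p.2 p.1]
  have e3 : coagWeak k φ μ = 1 / 2 * (∫ p, k p.1 p.2 * φ (p.1 + p.2) ∂(μ.prod μ) -
      ∫ p, k p.1 p.2 * φ p.1 ∂(μ.prod μ) - ∫ p, k p.1 p.2 * φ p.2 ∂(μ.prod μ)) := by
    have i12 : Integrable (fun p : PosReal × PosReal =>
        k p.1 p.2 * φ (p.1 + p.2) - k p.1 p.2 * φ p.1) (μ.prod μ) := i1.sub i2
    rw [coagWeak, ← integral_sub i1 i2, ← integral_sub i12 i3]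
    congr 2 with p
    simp only [coagIntegrand]
    ring
  rw [e1, e3, e2]
  simp only [smul_eq_mul]
  ring

theorem ae_le_eulerStep {a : PosReal} (hμ : ∀ᵐ x ∂μ, a ≤ x) (hη : ∀ᵐ x ∂η, a ≤ x) : ∀ᵐ x ∂(eulerStep h k η μ), a ≤ x := by
  rw [eulerStep, ae_add_measure_iff, ae_add_measure_iff]
  refine ⟨(withDensity_absolutelyContinuous _ _).ae_le hμ, ?_, Measure.ae_smul_measure hη _⟩
  refine Measure.ae_smul_measure ?_ _
  rw [ae_map_iff continuous_add_posReal.measurable.aemeasurable measurableSet_Ici]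
  filter_upwards [(withDensity_absolutelyContinuous _ _).ae_le (ae_le_prod hμ)] with p hp
  exact hp.1.trans (le_of_lt (by
    change (p.1 : ℝ) < ((p.1 + p.2 : PosReal) : ℝ)
    rw [Positive.coe_add]
    linarith [p.2.2]))

end

/-- Existence of the Euler step in the class of measures with bounded first moment. -/
theorem exists_eulerStep {a : PosReal} {k : PosReal → PosReal → ℝ} {N h : ℝ}
    (hk : Continuous (Function.uncurry k)) (hk0 : ∀ x y, 0 ≤ k x y)
    (hkN : ∀ x y, k x y ≤ N) (hsymm : ∀ x y, k x y = k y x) (h0 : 0 ≤ h) {M : ℝ≥0}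
    (hh : h * (N * (M / a)) ≤ 1) (η : FiniteMeasure PosReal)
    (hη : ∀ᵐ x ∂(η : Measure PosReal), a ≤ x)
    (hη1 : Integrable (fun x : PosReal => (x : ℝ)) (η : Measure PosReal))
    (μ : FiniteMeasure PosReal) (hμ : μ ∈ boundedMoment a M) :
    ∃ ν : FiniteMeasure PosReal, (∀ᵐ x ∂(ν : Measure PosReal), a ≤ x) ∧
      Integrable (fun x : PosReal => (x : ℝ)) (ν : Measure PosReal) ∧
      ∫ x : PosReal, (x : ℝ) ∂(ν : Measure PosReal) = ∫ x : PosReal, (x : ℝ) ∂(μ : Measure PosReal) +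
        h * ∫ x : PosReal, (x : ℝ) ∂(η : Measure PosReal) ∧
      ∀ φ : PosReal →ᵇ ℝ, ∫ x, φ x ∂(ν : Measure PosReal) = ∫ x, φ x ∂(μ : Measure PosReal) +
        h * (coagWeak k φ (μ : Measure PosReal) + ∫ x, φ x ∂(η : Measure PosReal)) := by
  have hN : 0 ≤ N := (hk0 a a).trans (hkN a a)
  -- The step-size condition makes the density `1 - h * lossRate` nonnegative, so `ENNReal.ofReal`
  -- does not truncate it.
  have hloss : ∀ x, h * lossRate k (μ : Measure PosReal) x ≤ 1 := fun x =>
    (mul_le_mul_of_nonneg_left ((lossRate_le hk0 hkN x).trans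
      (mul_le_mul_of_nonneg_left (boundedMoment.real_univ_le hμ) hN)) h0).trans hh
  have hadd : ∀ φ : PosReal →ᵇ ℝ, Integrable (fun p : PosReal × PosReal => φ (p.1 + p.2))
      ((μ : Measure PosReal).prod (μ : Measure PosReal)) := fun φ =>
    Integrable.of_bound (φ.continuous.comp continuous_add_posReal).aestronglyMeasurable ‖φ‖
      (Eventually.of_forall fun p => φ.norm_coe_le_norm _)
  have hfin : IsFiniteMeasure (eulerStep h k (η : Measure PosReal) (μ : Measure PosReal)) := by
    have := integrable_eulerStep (h := h) hk hk0 hkN hloss (φ := fun _ => (1 : ℝ)) measurable_const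
      (integrable_const _) (integrable_const (μ := (η : Measure PosReal)) _) (integrable_const _)
    exact (integrable_const_iff_isFiniteMeasure one_ne_zero).1 this
  have hμ1 := boundedMoment.integrable hμ
  have hx2 : Integrable (fun p : PosReal × PosReal => ((p.1 + p.2 : PosReal) : ℝ))
      ((μ : Measure PosReal).prod (μ : Measure PosReal)) :=
    (hμ1.comp_fst _).add (hμ1.comp_snd _)
  refine ⟨⟨_, hfin⟩, ae_le_eulerStep hμ.1 hη,
    integrable_eulerStep hk hk0 hkN hloss measurable_val hμ1 hη1 hx2, ?_, fun φ => ?_⟩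
  · refine (integral_eulerStep hk hk0 hkN hsymm h0 hloss measurable_val hμ1 hη1 hx2).trans ?_
    -- The size `x` is additive under coalescence, so only the source changes the first moment.
    have : coagWeak k (fun x : PosReal => (x : ℝ)) (μ : Measure PosReal) = 0 := by
      have : coagIntegrand k (fun x : PosReal => (x : ℝ)) = fun _ => 0 := by
        ext p
        simp [coagIntegrand]
      rw [coagWeak, this]
      simp
    rw [this, zero_add]
  · exact integral_eulerStep hk hk0 hkN hsymm h0 hloss φ.continuous.measurable
      (φ.integrable _) (φ.integrable _) (hadd φ)

/-! ### Step functions in time and Euler paths -/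

theorem natFloor_div_eqOn {h t : ℝ} (hh : 0 < h) (k : ℕ) (ht2 : t ≤ (k + 1) * h) (G : ℕ → ℝ) :
    EqOn (fun _ => G k) (fun s => G ⌊s / h⌋₊) (Ioo (k * h) t) := by
  intro s hs
  have : ⌊s / h⌋₊ = k := by
    rw [Nat.floor_eq_iff (div_nonneg ((by positivity : (0 : ℝ) ≤ k * h).trans hs.1.le) hh.le),
      le_div_iff₀ hh, div_lt_iff₀ hh]
    exact ⟨hs.1.le, hs.2.trans_le ht2⟩
  simp only [this]

theorem intervalIntegrable_natFloor_div_piece {h t : ℝ} (hh : 0 < h) (k : ℕ) (ht1 : k * h ≤ t)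
    (ht2 : t ≤ (k + 1) * h) (G : ℕ → ℝ) :
    IntervalIntegrable (fun s => G ⌊s / h⌋₊) volume (k * h) t ∧
      ∫ s in (k * h)..t, G ⌊s / h⌋₊ = (t - k * h) * G k := by
  have h1 := natFloor_div_eqOn hh k ht2 G
  constructor
  · exact (intervalIntegrable_const (c := G k)).congr_uIoo (by rwa [uIoo_of_le ht1])
  · rw [← intervalIntegral.integral_congr_Ioo_of_le ht1 h1, intervalIntegral.integral_const,
      smul_eq_mul]

theorem integral_natFloor_div_mul {h : ℝ} (hh : 0 < h) (k : ℕ) (G : ℕ → ℝ) :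
    IntervalIntegrable (fun s => G ⌊s / h⌋₊) volume 0 (k * h) ∧
      ∫ s in (0)..(k * h), G ⌊s / h⌋₊ = h * ∑ i ∈ Finset.range k, G i := by
  induction k with
  | zero => simp
  | succ k ih =>
    obtain ⟨h1, h2⟩ := intervalIntegrable_natFloor_div_piece hh k (t := (k + 1) * h) (by nlinarith)
      le_rfl G
    push_cast
    refine ⟨ih.1.trans h1, ?_⟩
    rw [← intervalIntegral.integral_add_adjacent_intervals ih.1 h1, ih.2, h2, Finset.sum_range_succ]
    ring

/-- The integral of a step function. -/
theorem integral_natFloor_div {h t : ℝ} (hh : 0 < h) (ht : 0 ≤ t) (G : ℕ → ℝ) :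
    IntervalIntegrable (fun s => G ⌊s / h⌋₊) volume 0 t ∧
      ∫ s in (0)..t, G ⌊s / h⌋₊ =
        h * ∑ i ∈ Finset.range ⌊t / h⌋₊, G i + (t - ⌊t / h⌋₊ * h) * G ⌊t / h⌋₊ := by
  have h0 := integral_natFloor_div_mul hh ⌊t / h⌋₊ G
  have h3 : (⌊t / h⌋₊ : ℝ) * h ≤ t := by
    rw [← le_div_iff₀ hh]; exact Nat.floor_le (by positivity)
  have h4 : t ≤ ((⌊t / h⌋₊ : ℝ) + 1) * h := by
    rw [← div_le_iff₀ hh]; exact (Nat.lt_floor_add_one _).le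
  have h1 := intervalIntegrable_natFloor_div_piece hh ⌊t / h⌋₊ h3 h4 G
  exact ⟨h0.1.trans h1.1, by
    rw [← intervalIntegral.integral_add_adjacent_intervals h0.1 h1.1, h0.2, h1.2]⟩

/-- Iterates of the Euler step. -/
theorem exists_eulerSeq {a : PosReal} {k : PosReal → PosReal → ℝ} {N h : ℝ}
    (hk : Continuous (Function.uncurry k)) (hk0 : ∀ x y, 0 ≤ k x y)
    (hkN : ∀ x y, k x y ≤ N) (hsymm : ∀ x y, k x y = k y x) (h0 : 0 ≤ h) {M M₀ Mη : ℝ≥0} (j : ℕ)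
    (hM : M₀ + j * h * Mη ≤ M) (hh : h * (N * (M / a)) ≤ 1) {f₀ η : FiniteMeasure PosReal}
    (hη : η ∈ boundedMoment a Mη) (hf₀ : f₀ ∈ boundedMoment a M₀) :
    ∃ u : ℕ → FiniteMeasure PosReal, u 0 = f₀ ∧ (∀ i ≤ j, u i ∈ boundedMoment a M) ∧
      ∀ i < j, ∀ φ : PosReal →ᵇ ℝ,
        ∫ x, φ x ∂(u (i + 1) : Measure PosReal) = ∫ x, φ x ∂(u i : Measure PosReal) +
          h * (coagWeak k φ (u i : Measure PosReal) + ∫ x, φ x ∂(η : Measure PosReal)) := by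
  -- `stp` is defined on all finite measures but controlled only on `boundedMoment a M`; the
  -- induction below shows that the first `j` iterates stay there.
  choose! stp s1 s2 s3 s4 using exists_eulerStep hk hk0 hkN hsymm h0 hh η hη.1
    (boundedMoment.integrable hη)
  have hη2 := boundedMoment.integral_le hη
  have key : ∀ i ≤ j, (∀ᵐ x ∂((stp^[i] f₀ : FiniteMeasure PosReal) : Measure PosReal), a ≤ x) ∧
      Integrable (fun x : PosReal => (x : ℝ)) ((stp^[i] f₀ : FiniteMeasure PosReal) : Measure PosReal) ∧
      ∫ x : PosReal, (x : ℝ) ∂((stp^[i] f₀ : FiniteMeasure PosReal) : Measure PosReal) ≤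
        M₀ + i * h * Mη := by
    intro i
    induction i with
    | zero =>
      intro _
      refine ⟨hf₀.1, boundedMoment.integrable hf₀, ?_⟩
      simpa using boundedMoment.integral_le hf₀
    | succ i ih =>
      intro hi
      obtain ⟨i1, i2, i3⟩ := ih (by omega)
      have hm : stp^[i] f₀ ∈ boundedMoment a M := by
        refine mem_boundedMoment_of_integral_le i1 i2 (i3.trans (le_trans ?_ hM))
        have : (i : ℝ) ≤ j := by exact_mod_cast (by omega : i ≤ j)
        gcongr
      rw [Function.iterate_succ_apply']
      refine ⟨s1 _ hm, s2 _ hm, ?_⟩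
      rw [s3 _ hm]
      have := mul_le_mul_of_nonneg_left hη2 h0
      push_cast
      linarith
  have hmem : ∀ i ≤ j, stp^[i] f₀ ∈ boundedMoment a M := by
    intro i hi
    obtain ⟨i1, i2, i3⟩ := key i hi
    refine mem_boundedMoment_of_integral_le i1 i2 (i3.trans (le_trans ?_ hM))
    have : (i : ℝ) ≤ j := by exact_mod_cast hi
    gcongr
  refine ⟨fun i => stp^[i] f₀, rfl, hmem, fun i hi φ => ?_⟩
  simp only [Function.iterate_succ_apply']
  exact s4 _ (hmem i hi.le) φ

/-- The rate of change of `∫ φ dμ` under coagulation and source. -/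
def rate (k : PosReal → PosReal → ℝ) (η : FiniteMeasure PosReal) (φ : PosReal →ᵇ ℝ)
    (μ : FiniteMeasure PosReal) : ℝ :=
  coagWeak k φ (μ : Measure PosReal) + ∫ x, φ x ∂(η : Measure PosReal)

theorem abs_integral_le_mass (φ : PosReal →ᵇ ℝ) (μ : FiniteMeasure PosReal) :
    |∫ x, φ x ∂(μ : Measure PosReal)| ≤ (μ : Measure PosReal).real univ * ‖φ‖ := by
  rw [mul_comm]
  exact norm_integral_le_of_norm_le_const (Eventually.of_forall fun x => φ.norm_coe_le_norm x)

theorem abs_rate_le {a : PosReal} {k : PosReal → PosReal → ℝ} {A : ℝ} {M : ℝ≥0} (hA0 : 0 ≤ A)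
    (hA : ∀ x y, a ≤ x → a ≤ y → |k x y| ≤ A * (x * y)) {μ η : FiniteMeasure PosReal}
    (hμ : μ ∈ boundedMoment a M) (φ : PosReal →ᵇ ℝ) :
    |rate k η φ μ| ≤ (3 / 2 * A * M ^ 2 + (η : Measure PosReal).real univ) * ‖φ‖ := by
  rw [add_mul]
  exact (abs_add_le _ _).trans (add_le_add (abs_coagWeak_le hA0 hA hμ φ) (abs_integral_le_mass φ η))

/-- Piecewise constant approximate solutions for bounded kernels. -/
theorem exists_eulerPath {a : PosReal} {k : PosReal → PosReal → ℝ} {N A T : ℝ}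
    (hk : Continuous (Function.uncurry k)) (hk0 : ∀ x y, 0 ≤ k x y)
    (hkN : ∀ x y, k x y ≤ N) (hsymm : ∀ x y, k x y = k y x) (hA0 : 0 ≤ A)
    (hA : ∀ x y, a ≤ x → a ≤ y → |k x y| ≤ A * (x * y)) (hT : 0 < T) {M M₀ Mη : ℝ≥0} {j : ℕ}
    (hj : 0 < j) (hM : M₀ + T * Mη ≤ M) (hh : T / j * (N * (M / a)) ≤ 1)
    {f₀ η : FiniteMeasure PosReal}
    (hη : η ∈ boundedMoment a Mη) (hf₀ : f₀ ∈ boundedMoment a M₀) :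
    ∃ g : ℝ → FiniteMeasure PosReal, (∀ t, g t ∈ boundedMoment a M) ∧
      ∀ φ : PosReal →ᵇ ℝ, ∀ t ∈ Icc 0 T,
        IntervalIntegrable (fun s => rate k η φ (g s)) volume 0 t ∧
        |∫ x, φ x ∂(g t : Measure PosReal) - ∫ x, φ x ∂(f₀ : Measure PosReal) -
          ∫ s in (0)..t, rate k η φ (g s)| ≤
          T / j * ((3 / 2 * A * M ^ 2 + (η : Measure PosReal).real univ) * ‖φ‖) := by
  have hj' : (0 : ℝ) < j := by exact_mod_cast hj
  have hstep : 0 < T / j := by positivity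
  obtain ⟨u, u0, u1, u2⟩ := exists_eulerSeq hk hk0 hkN hsymm hstep.le (M₀ := M₀) (Mη := Mη) j
    (by rwa [mul_div_cancel₀ _ hj'.ne']) hh hη hf₀
  have hfl : ∀ t ≤ T, ⌊t / (T / j)⌋₊ ≤ j := by
    intro t ht
    refine Nat.floor_le_of_le ?_
    rw [div_le_iff₀ hstep, mul_div_cancel₀ _ hj'.ne']
    exact ht
  -- Freezing the path after `T` keeps the index at most `j`; negative times have floor `0`.
  refine ⟨fun t => u ⌊min t T / (T / j)⌋₊, fun t => u1 _ (hfl _ (min_le_right _ _)), ?_⟩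
  intro φ t ht
  set G : ℕ → ℝ := fun i => rate k η φ (u i)
  obtain ⟨g1, g2⟩ := integral_natFloor_div hstep ht.1 G
  have heq : EqOn (fun s => G ⌊s / (T / j)⌋₊) (fun s => rate k η φ (u ⌊min s T / (T / j)⌋₊))
      (Ioo 0 t) := by
    intro s hs
    simp only [G, min_eq_left (hs.2.le.trans ht.2)]
  refine ⟨g1.congr_uIoo (by rwa [uIoo_of_le ht.1]), ?_⟩
  rw [← intervalIntegral.integral_congr_Ioo_of_le ht.1 heq, g2]
  simp only [min_eq_left ht.2]
  have tele : ∀ i ≤ j, ∫ x, φ x ∂(u i : Measure PosReal) - ∫ x, φ x ∂(f₀ : Measure PosReal) =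
      T / j * ∑ m ∈ Finset.range i, G m := by
    intro i
    induction i with
    | zero => intro _; simp [u0]
    | succ i ih =>
      intro hi
      rw [Finset.sum_range_succ, mul_add, ← ih (by omega), u2 i (by omega)]
      simp only [G, rate]
      ring
  have hflt := hfl t ht.2
  -- The completed steps cancel exactly against the integral, so the error is the integral over the
  -- unfinished last step.
  rw [tele _ hflt]
  have h3 : (⌊t / (T / j)⌋₊ : ℝ) * (T / j) ≤ t := by
    rw [← le_div_iff₀ hstep]; exact Nat.floor_le (div_nonneg ht.1 hstep.le)
  have h4 : t ≤ ((⌊t / (T / j)⌋₊ : ℝ) + 1) * (T / j) := by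
    rw [← div_le_iff₀ hstep]; exact (Nat.lt_floor_add_one _).le
  rw [sub_add_cancel_left, abs_neg, abs_mul, abs_of_nonneg (sub_nonneg.2 h3)]
  exact mul_le_mul (by linarith) (abs_rate_le hA0 hA (u1 _ hflt) φ) (abs_nonneg _) hstep.le

/-! ### Compactness of paths and passage to the limit -/

section

variable {a : PosReal} {M : ℝ≥0} {K : PosReal → PosReal → ℝ} {T : ℝ}

theorem exists_subseq_boundedMoment {μs : ℕ → FiniteMeasure PosReal}
    (h : ∀ n, μs n ∈ boundedMoment a M) :
    ∃ μ ∈ boundedMoment a M, ∃ σ : ℕ → ℕ, StrictMono σ ∧ Tendsto (μs ∘ σ) atTop (𝓝 μ) := by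
  have := metrizableSpace_boundedMoment a M
  have : CompactSpace (boundedMoment a M) :=
    isCompact_iff_compactSpace.mp (isCompact_boundedMoment a M)
  obtain ⟨μ, σ, hσ, hlim⟩ := CompactSpace.tendsto_subseq (fun n => (⟨μs n, h n⟩ : boundedMoment a M))
  exact ⟨μ, μ.2, σ, hσ, (continuous_subtype_val.tendsto _).comp hlim⟩

/-- Sequential compactness of a countable product of compact metrizable spaces replaces a diagonal
extraction. -/
theorem exists_subseq_rat {g : ℕ → ℝ → FiniteMeasure PosReal}
    (hg : ∀ n t, g n t ∈ boundedMoment a M) :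
    ∃ σ : ℕ → ℕ, StrictMono σ ∧ ∃ b : ℚ → FiniteMeasure PosReal,
      ∀ q : ℚ, Tendsto (fun n => g (σ n) q) atTop (𝓝 (b q)) := by
  have := metrizableSpace_boundedMoment a M
  have : CompactSpace (boundedMoment a M) :=
    isCompact_iff_compactSpace.mp (isCompact_boundedMoment a M)
  obtain ⟨b, σ, hσ, hlim⟩ := CompactSpace.tendsto_subseq
    (fun (n : ℕ) (q : ℚ) => (⟨g n q, hg n q⟩ : boundedMoment a M))
  refine ⟨σ, hσ, fun q => b q, fun q => ?_⟩
  exact (continuous_subtype_val.tendsto _).comp (tendsto_pi_nhds.1 hlim q)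

/-- Compactness of asymptotically Lipschitz paths of measures with bounded first moment. -/
theorem exists_subseq_path {g : ℕ → ℝ → FiniteMeasure PosReal}
    (hg : ∀ n t, g n t ∈ boundedMoment a M) {C : ℝ} (hC : 0 ≤ C) {ε : ℕ → ℝ}
    (hε : Tendsto ε atTop (𝓝 0))
    (hlip : ∀ n, ∀ φ : PosReal →ᵇ ℝ, ∀ s t : ℝ,
      |∫ x, φ x ∂(g n t : Measure PosReal) - ∫ x, φ x ∂(g n s : Measure PosReal)| ≤
        C * ‖φ‖ * (|t - s| + ε n)) :
    ∃ σ : ℕ → ℕ, StrictMono σ ∧ ∃ f : ℝ → FiniteMeasure PosReal,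
      ∀ t, f t ∈ boundedMoment a M ∧ Tendsto (fun n => g (σ n) t) atTop (𝓝 (f t)) := by
  obtain ⟨σ, hσ, b, hb⟩ := exists_subseq_rat hg
  have hεσ : Tendsto (fun n => ε (σ n)) atTop (𝓝 0) := hε.comp hσ.tendsto_atTop
  have hcauchy : ∀ t : ℝ, ∀ φ : PosReal →ᵇ ℝ,
      CauchySeq fun n => ∫ x, φ x ∂(g (σ n) t : Measure PosReal) := by
    intro t φ
    rw [Metric.cauchySeq_iff]
    intro δ hδ
    set B := C * ‖φ‖ + 1
    have hB : 0 < B := by positivity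
    obtain ⟨q, hq⟩ := Rat.denseRange_cast.exists_dist_lt t (by positivity : 0 < δ / 8 / B)
    have hq1 : |t - q| * B < δ / 8 := by
      rw [← lt_div_iff₀ hB]
      exact hq
    have e1 : ∀ᶠ n in atTop, ε (σ n) < δ / 8 / B := hεσ.eventually_lt_const (by positivity)
    have e2 := Metric.tendsto_nhds.1 (FiniteMeasure.tendsto_iff_forall_integral_tendsto.1 (hb q) φ)
      (δ / 4) (by positivity)
    obtain ⟨n₀, hn₀⟩ := eventually_atTop.1 (e1.and e2)
    have key : ∀ n ≥ n₀, |∫ x, φ x ∂(g (σ n) t : Measure PosReal) -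
        ∫ x, φ x ∂(b q : Measure PosReal)| < δ / 2 := by
      intro n hn
      obtain ⟨h1, h2⟩ := hn₀ n hn
      rw [lt_div_iff₀ hB] at h1
      rw [Real.dist_eq] at h2
      have h3 := hlip (σ n) φ q t
      -- `ε` is only assumed to tend to zero, so it may be negative.
      have h0 : 0 ≤ |t - (q : ℝ)| + ε (σ n) ∨ |t - (q : ℝ)| + ε (σ n) < 0 := le_or_gt _ _
      have h4 : C * ‖φ‖ * (|t - q| + ε (σ n)) < δ / 4 := by
        rcases h0 with h0 | h0
        · have : C * ‖φ‖ * (|t - q| + ε (σ n)) ≤ B * (|t - q| + ε (σ n)) :=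
            mul_le_mul_of_nonneg_right (by simp [B]) h0
          nlinarith
        · exact (mul_nonpos_of_nonneg_of_nonpos (by positivity) h0.le).trans_lt (by positivity)
      rw [abs_lt] at h2 ⊢
      have h5 := abs_le.1 (h3.trans h4.le)
      constructor <;> linarith [h5.1, h5.2]
    refine ⟨n₀, fun m hm n hn => ?_⟩
    have k1 := abs_lt.1 (key m hm)
    have k2 := abs_lt.1 (key n hn)
    rw [Real.dist_eq, abs_lt]
    constructor <;> linarith
  -- Compactness provides a limit measure along a further subsequence depending on `t`; the Cauchy
  -- property makes the whole sequence converge to it.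
  have hex : ∀ t : ℝ, ∃ μ, μ ∈ boundedMoment a M ∧ Tendsto (fun n => g (σ n) t) atTop (𝓝 μ) := by
    intro t
    obtain ⟨μ, hμ, τ, hτ, hlim⟩ := exists_subseq_boundedMoment (fun n => hg (σ n) t)
    refine ⟨μ, hμ, FiniteMeasure.tendsto_of_forall_integral_tendsto fun φ => ?_⟩
    exact tendsto_nhds_of_cauchySeq_of_subseq (hcauchy t φ) hτ.tendsto_atTop
      (FiniteMeasure.tendsto_iff_forall_integral_tendsto.1 hlim φ)
  choose f hf using hex
  exact ⟨σ, hσ, f, hf⟩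

theorem abs_truncKernel_sub_le {m N ε : ℝ} (hmN : m ≤ N) {x y : PosReal} (hε : 0 ≤ ε * (x * y))
    (h : K x y ≤ m + ε * (x * y)) : |truncKernel K N x y - truncKernel K m x y| ≤ ε * (x * y) := by
  have h1 : truncKernel K m x y ≤ truncKernel K N x y := min_le_min_left _ hmN
  rw [abs_of_nonneg (sub_nonneg.2 h1), sub_le_iff_le_add, truncKernel, truncKernel,
    ← min_add_add_left]
  exact le_min ((min_le_left _ _).trans (by linarith)) ((min_le_left _ _).trans (by linarith))

/-- A path whose integrals satisfy the integral equation up to an error is Lipschitz up to that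
error. -/
theorem abs_integral_sub_le_of_integral_eq {C e I₀ : ℝ} {y r : ℝ → ℝ}
    (hr : ∀ s, |r s| ≤ C) (h : ∀ t ∈ Icc 0 T, IntervalIntegrable r volume 0 t ∧
      |y t - I₀ - ∫ s in (0)..t, r s| ≤ e) {s t : ℝ} (hs : s ∈ Icc 0 T) (ht : t ∈ Icc 0 T) :
    |y t - y s| ≤ C * |t - s| + 2 * e := by
  obtain ⟨i1, e1⟩ := h s hs
  obtain ⟨i2, e2⟩ := h t ht
  have h1 : |∫ x in s..t, r x| ≤ C * |t - s| := by
    rw [← Real.norm_eq_abs]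
    exact intervalIntegral.norm_integral_le_of_norm_le_const fun x _ => hr x
  rw [← intervalIntegral.integral_interval_sub_left i2 i1] at h1
  rw [abs_le] at *
  constructor <;> linarith

/-- Existence of weakly continuous solutions of the integral equation. -/
theorem exists_integral_solution (hK : SublinearKernel a K) (hsymm : ∀ x y, K x y = K y x)
    (hT : 0 < T) {M₀ Mη : ℝ≥0} {f₀ η : FiniteMeasure PosReal} (hη : η ∈ boundedMoment a Mη)
    (hf₀ : f₀ ∈ boundedMoment a M₀) :
    ∃ M : ℝ≥0, ∃ f : ℝ → FiniteMeasure PosReal, (∀ t, f t ∈ boundedMoment a M) ∧ Continuous f ∧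
      ∀ φ : PosReal →ᵇ ℝ, ∀ t ∈ Icc 0 T,
        ∫ x, φ x ∂(f t : Measure PosReal) - ∫ x, φ x ∂(f₀ : Measure PosReal) =
          ∫ s in (0)..t, rate K η φ (f s) := by
  obtain ⟨A, hA0, hA⟩ := hK.exists_le_mul
  obtain ⟨M, hM⟩ : ∃ M : ℝ≥0, M₀ + T * Mη ≤ M :=
    ⟨M₀ + T.toNNReal * Mη, by simp [Real.coe_toNNReal _ hT.le]⟩
  have hktr : ∀ n : ℕ, SublinearKernel a (truncKernel K n) := fun n => hK.truncKernel n.cast_nonneg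
  have hkA : ∀ (n : ℕ) x y, a ≤ x → a ≤ y → |truncKernel K n x y| ≤ A * (x * y) :=
    fun n x y hx hy => by
      rw [abs_of_nonneg ((hktr n).nonneg x y)]
      exact (min_le_left _ _).trans (hA x y hx hy)
  have ha := a.2
  -- The ceiling ensures positivity of the Euler step for the kernel truncated at `n`; the summand
  -- `n + 1` forces the step size to zero.
  let j : ℕ → ℕ := fun n => ⌈T * (n * (M / a))⌉₊ + (n + 1)
  have hj : ∀ n, 0 < j n := fun n => by simp [j]
  have hjT : ∀ n, T / j n * (n * (M / a)) ≤ 1 := by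
    intro n
    rw [div_mul_eq_mul_div, div_le_one (by exact_mod_cast hj n)]
    refine (Nat.le_ceil _).trans ?_
    simp only [j]
    push_cast
    linarith [(n.cast_nonneg : (0 : ℝ) ≤ n)]
  have hjlim : Tendsto (fun n => T / j n) atTop (𝓝 0) := by
    have h1 := (tendsto_one_div_add_atTop_nhds_zero_nat (𝕜 := ℝ)).const_mul T
    rw [mul_zero] at h1
    refine squeeze_zero (fun n => by positivity) (fun n => ?_) h1
    rw [mul_one_div]
    refine div_le_div_of_nonneg_left hT.le (by positivity) ?_
    simp only [j]
    push_cast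
    linarith [(Nat.cast_nonneg _ : (0 : ℝ) ≤ (⌈T * (n * (M / a))⌉₊ : ℝ))]
  choose g hgM hg using fun n : ℕ => exists_eulerPath (hktr n).continuous (hktr n).nonneg
    (fun x y => min_le_right _ _) (fun x y => by rw [truncKernel, truncKernel, hsymm]) hA0 (hkA n)
    hT (hj n) hM (hjT n) hη hf₀
  set C := 3 / 2 * A * (M : ℝ) ^ 2 + (η : Measure PosReal).real univ
  have hC : 0 ≤ C := by positivity
  have hrate : ∀ (n : ℕ) (φ : PosReal →ᵇ ℝ) s, |rate (truncKernel K n) η φ (g n s)| ≤ C * ‖φ‖ :=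
    fun n φ s => abs_rate_le hA0 (hkA n) (hgM n s) φ
  -- Estimates are available only on `[0, T]`; composing with this 1-Lipschitz projection extends
  -- the paths to all times.
  let c : ℝ → ℝ := fun t => projIcc 0 T hT.le t
  have hc : ∀ t, c t ∈ Icc 0 T := fun t => (projIcc 0 T hT.le t).2
  have hcc : ∀ s t, |c t - c s| ≤ |t - s| := fun s t => by
    have := (LipschitzWith.projIcc hT.le).dist_le_mul t s
    simpa [Real.dist_eq, Subtype.dist_eq] using this
  have hcid : ∀ t ∈ Icc 0 T, c t = t := fun t ht => by simp only [c, projIcc_of_mem hT.le ht]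
  have hlim0 : Tendsto (fun n => 2 * (T / j n)) atTop (𝓝 0) := by
    simpa using hjlim.const_mul 2
  obtain ⟨σ, hσ, f, hf⟩ := exists_subseq_path (g := fun n t => g n (c t))
    (fun n t => hgM n (c t)) hC hlim0 (fun n φ s t => by
      refine (abs_integral_sub_le_of_integral_eq (hrate n φ) (hg n φ) (hc s) (hc t)).trans ?_
      have := mul_le_mul_of_nonneg_left (hcc s t) (by positivity : 0 ≤ C * ‖φ‖)
      linarith)
  have hint : ∀ (φ : PosReal →ᵇ ℝ) t, Tendsto (fun n => ∫ x, φ x ∂(g (σ n) (c t) : Measure PosReal))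
      atTop (𝓝 (∫ x, φ x ∂(f t : Measure PosReal))) := fun φ t =>
    FiniteMeasure.tendsto_iff_forall_integral_tendsto.1 (hf t).2 φ
  have hjσ : Tendsto (fun n => T / j (σ n)) atTop (𝓝 0) := hjlim.comp hσ.tendsto_atTop
  refine ⟨M, f, fun t => (hf t).1, ?_, ?_⟩
  -- The step-size error vanishes in the limit, leaving a genuine Lipschitz bound for each test
  -- function.
  · rw [FiniteMeasure.continuous_iff_forall_continuous_integral]
    intro φ
    refine (LipschitzWith.of_dist_le_mul (K := (C * ‖φ‖).toNNReal) fun t s => ?_).continuous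
    rw [Real.dist_eq, Real.dist_eq, Real.coe_toNNReal _ (by positivity)]
    have h2 : Tendsto (fun n => C * ‖φ‖ * |t - s| + 2 * (T / j (σ n) * (C * ‖φ‖))) atTop
        (𝓝 (C * ‖φ‖ * |t - s|)) := by
      simpa using ((hjσ.mul_const (C * ‖φ‖)).const_mul 2).const_add (C * ‖φ‖ * |t - s|)
    refine le_of_tendsto_of_tendsto' ((hint φ t).sub (hint φ s)).abs h2 fun n => ?_
    refine (abs_integral_sub_le_of_integral_eq (hrate _ φ) (hg _ φ) (hc s) (hc t)).trans ?_
    have := mul_le_mul_of_nonneg_left (hcc s t) (by positivity : 0 ≤ C * ‖φ‖)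
    linarith
  · intro φ t ht
    have hptw : ∀ s ∈ Icc 0 T, Tendsto (fun n => rate (truncKernel K (σ n)) η φ (g (σ n) s)) atTop
        (𝓝 (rate K η φ (f s))) := by
      intro s hs
      refine Tendsto.add_const _ ?_
      refine tendsto_coagWeak hK (fun n => (hktr (σ n)).continuous) (fun n => hkA (σ n)) ?_
        (fun n => hgM _ _) (hf s).1 (by simpa only [hcid s hs] using (hf s).2) φ
      intro m ε hε hm
      have h1 : Tendsto (fun n => ((σ n : ℕ) : ℝ)) atTop atTop :=
        tendsto_natCast_atTop_atTop.comp hσ.tendsto_atTop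
      filter_upwards [h1.eventually_ge_atTop m] with n hn x y hx hy
      exact abs_truncKernel_sub_le hn (by have := x.2; have := y.2; positivity) (hm x y hx hy)
    have hI : Tendsto (fun n => ∫ s in (0)..t, rate (truncKernel K (σ n)) η φ (g (σ n) s)) atTop
        (𝓝 (∫ s in (0)..t, rate K η φ (f s))) := by
      refine intervalIntegral.tendsto_integral_filter_of_dominated_convergence (fun _ => C * ‖φ‖)
        (Eventually.of_forall fun n => ?_) (Eventually.of_forall fun n => ?_)
        intervalIntegrable_const (Eventually.of_forall fun s hs => ?_)
      · exact (intervalIntegrable_iff.1 (hg (σ n) φ t ht).1).aestronglyMeasurable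
      · exact Eventually.of_forall fun s _ => hrate _ φ s
      · rw [uIoc_of_le ht.1] at hs
        exact hptw s ⟨hs.1.le, hs.2.trans ht.2⟩
    have h1 := (((hint φ t).sub_const (∫ x, φ x ∂(f₀ : Measure PosReal))).sub hI).abs
    have h2 : Tendsto (fun n => T / j (σ n) * (C * ‖φ‖)) atTop (𝓝 0) := by
      simpa using hjσ.mul_const (C * ‖φ‖)
    have h3 := le_of_tendsto_of_tendsto' h1 h2 fun n => by
      simp only [hcid t ht]
      exact (hg (σ n) φ t ht).2
    exact sub_eq_zero.1 (abs_nonpos_iff.1 h3)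

/-! ### Sublinearity of the kernel and symmetrization -/

/-- For large `z`, `D * z ^ θ` is `z` times a factor tending to zero, because `θ < 1`; for small `z`
monotonicity gives the constant. -/
theorem exists_mul_rpow_le (D θ ε : ℝ) (hD : 0 ≤ D) (hθ0 : 0 ≤ θ) (hθ : θ < 1) (hε : 0 < ε) :
    ∃ m : ℝ, ∀ z : ℝ, 0 < z → D * z ^ θ ≤ m + ε * z := by
  have h1 : Tendsto (fun z : ℝ => D * z ^ (-(1 - θ))) atTop (𝓝 0) := by
    simpa using (tendsto_rpow_neg_atTop (sub_pos.2 hθ)).const_mul D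
  obtain ⟨R, hR⟩ := eventually_atTop.1 ((h1.eventually_lt_const hε).and (eventually_gt_atTop 0))
  have hR0 : 0 < R := (hR R le_rfl).2
  refine ⟨D * R ^ θ, fun z hz => ?_⟩
  rcases le_total z R with hzR | hzR
  · have := mul_le_mul_of_nonneg_left (Real.rpow_le_rpow hz.le hzR hθ0) hD
    nlinarith
  · have h2 : D * z ^ θ = D * z ^ (-(1 - θ)) * z := by
      rw [mul_assoc, ← Real.rpow_add_one hz.ne']
      congr 2
      ring
    have h3 := mul_le_mul_of_nonneg_right (hR z hzR).1.le hz.le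
    have h4 : 0 ≤ D * R ^ θ := by positivity
    linarith

theorem rpow_le_mul_rpow {x : PosReal} (hx : a ≤ x) {p θ : ℝ} (h : p ≤ θ) :
    (x : ℝ) ^ p ≤ (a : ℝ) ^ (p - θ) * (x : ℝ) ^ θ := by
  have h1 : (x : ℝ) ^ p = (x : ℝ) ^ (p - θ) * (x : ℝ) ^ θ := by
    rw [← Real.rpow_add x.2, sub_add_cancel]
  rw [h1]
  exact mul_le_mul_of_nonneg_right
    (Real.rpow_le_rpow_of_nonpos a.2 hx (sub_nonpos.2 h)) (Real.rpow_nonneg x.2.le _)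

/-- With `θ` the maximum of both exponents and `0`, each product of powers is at most a constant
times `(x * y) ^ θ` on `[a, ∞)²`. The individual conditions on the exponents give `θ < 1`; no
condition on their sum enters. -/
theorem KernelRegularity.sublinearKernel {γ lam : ℝ} (hlam : -lam < 1) (hγlam : γ + lam < 1)
    (hK : KernelRegularity γ lam K) (a : PosReal) : SublinearKernel a K := by
  obtain ⟨c₁, c₂, hc₁, hc₁₂, hb⟩ := hK.bounds
  have hc₂ : 0 < c₂ := hc₁.trans_le hc₁₂
  refine ⟨hK.continuous, fun x y => le_trans ?_ (hb x y).1, fun ε hε => ?_⟩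
  · have := x.2
    have := y.2
    positivity
  set θ := max (max (γ + lam) (-lam)) 0
  have hα : γ + lam ≤ θ := (le_max_left _ _).trans (le_max_left _ _)
  have hβ : -lam ≤ θ := (le_max_right _ _).trans (le_max_left _ _)
  have hθ : θ < 1 := max_lt (max_lt hγlam hlam) one_pos
  have ha := a.2
  obtain ⟨m, hm⟩ := exists_mul_rpow_le
    (c₂ * (2 * ((a : ℝ) ^ (γ + lam - θ) * (a : ℝ) ^ (-lam - θ)))) θ ε (by positivity)
    (le_max_right _ _) hθ hε
  refine ⟨m, fun x y hx hy => (hb x y).2.trans (le_trans ?_ (hm (x * y) (mul_pos x.2 y.2)))⟩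
  have hx0 := x.2
  have hy0 := y.2
  have h1 := mul_le_mul (rpow_le_mul_rpow hx hα) (rpow_le_mul_rpow hy hβ)
    (by positivity) (by positivity)
  have h2 := mul_le_mul (rpow_le_mul_rpow hx hβ) (rpow_le_mul_rpow hy hα)
    (by positivity) (by positivity)
  rw [Real.mul_rpow hx0.le hy0.le, mul_assoc c₂]
  refine mul_le_mul_of_nonneg_left ?_ hc₂.le
  refine (add_le_add h1 h2).trans (le_of_eq ?_)
  ring

/-- The symmetrization of a kernel. -/
def symmKernel (K : PosReal → PosReal → ℝ) (x y : PosReal) : ℝ := (K x y + K y x) / 2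

theorem SublinearKernel.symmKernel (hK : SublinearKernel a K) :
    SublinearKernel a (symmKernel K) where
  continuous := (hK.continuous.add (hK.continuous.comp continuous_swap)).div_const 2
  nonneg x y := div_nonneg (add_nonneg (hK.nonneg x y) (hK.nonneg y x)) two_pos.le
  sublinear ε hε := (hK.sublinear ε hε).imp fun _ hm x y hx hy => by
    have h1 := hm x y hx hy
    have h2 := hm y x hy hx
    rw [mul_comm (y : ℝ)] at h2
    rw [Coagulation.symmKernel, div_le_iff₀ two_pos]
    linarith

theorem SublinearKernel.exists_abs_le_mul (hK : SublinearKernel a K) :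
    ∃ A : ℝ, 0 ≤ A ∧ ∀ x y : PosReal, a ≤ x → a ≤ y → |K x y| ≤ A * (x * y) := by
  obtain ⟨A, hA0, hA⟩ := hK.exists_le_mul
  exact ⟨A, hA0, fun x y hx hy => by rw [abs_of_nonneg (hK.nonneg x y)]; exact hA x y hx hy⟩

/-- The test expression and `μ.prod μ` are invariant under swapping, so only the symmetric part of
`K` matters. The Euler scheme can thus use a symmetric kernel. -/
theorem coagWeak_symmKernel (hK : SublinearKernel a K) {μ : FiniteMeasure PosReal}
    (hμ : μ ∈ boundedMoment a M) (φ : PosReal →ᵇ ℝ) :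
    coagWeak (symmKernel K) φ (μ : Measure PosReal) = coagWeak K φ (μ : Measure PosReal) := by
  obtain ⟨A, -, hA⟩ := hK.exists_abs_le_mul
  have i1 := integrable_coagIntegrand hK.continuous hA hμ φ
  have h1 : ∫ p, coagIntegrand K φ p.swap ∂((μ : Measure PosReal).prod (μ : Measure PosReal)) =
      ∫ p, coagIntegrand K φ p ∂((μ : Measure PosReal).prod (μ : Measure PosReal)) :=
    integral_prod_swap _
  have h2 : coagIntegrand (symmKernel K) φ =
      fun p => (coagIntegrand K φ p + coagIntegrand K φ p.swap) / 2 := by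
    ext p
    simp only [coagIntegrand, symmKernel, Prod.fst_swap, Prod.snd_swap, add_comm p.2 p.1]
    ring
  have i2 : Integrable (fun p => coagIntegrand K φ p.swap)
      ((μ : Measure PosReal).prod (μ : Measure PosReal)) := i1.swap
  rw [coagWeak, coagWeak, h2, integral_div, integral_add i1 i2, h1]
  ring

/-! ### Time-dependent test functions -/

theorem abs_integral_zeroAtInfty_le (ψ : C₀(PosReal, ℝ)) (μ : FiniteMeasure PosReal) :
    |∫ x, ψ x ∂(μ : Measure PosReal)| ≤ (μ : Measure PosReal).real univ * ‖ψ‖ :=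
  abs_integral_le_mass ψ.toBCF μ

theorem integrable_zeroAtInfty (ψ : C₀(PosReal, ℝ)) (μ : FiniteMeasure PosReal) :
    Integrable (fun x => ψ x) (μ : Measure PosReal) :=
  ψ.toBCF.integrable _

/-- Joint continuity of the pairing of functions and measures. -/
theorem tendsto_integral_zeroAtInfty {ι : Type*} {l : Filter ι} {ψs : ι → C₀(PosReal, ℝ)}
    {ψ : C₀(PosReal, ℝ)} {μs : ι → FiniteMeasure PosReal} {μ : FiniteMeasure PosReal}
    (hψ : Tendsto ψs l (𝓝 ψ)) (hμ : Tendsto μs l (𝓝 μ)) :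
    Tendsto (fun i => ∫ x, ψs i x ∂(μs i : Measure PosReal)) l
      (𝓝 (∫ x, ψ x ∂(μ : Measure PosReal))) := by
  have h1 : Tendsto (fun i => ∫ x, ψ x ∂(μs i : Measure PosReal)) l
      (𝓝 (∫ x, ψ x ∂(μ : Measure PosReal))) :=
    FiniteMeasure.tendsto_iff_forall_integral_tendsto.1 hμ ψ.toBCF
  have h2 : Tendsto (fun i => ((μs i : Measure PosReal).real univ) * ‖ψs i - ψ‖) l (𝓝 0) := by
    have hm : Tendsto (fun i => (μs i : Measure PosReal).real univ) l
        (𝓝 ((μ : Measure PosReal).real univ)) := by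
      simpa using (NNReal.tendsto_coe.2 hμ.mass)
    simpa using hm.mul (tendsto_iff_norm_sub_tendsto_zero.1 hψ)
  have h3 := (squeeze_zero_norm (fun i => abs_integral_zeroAtInfty_le (ψs i - ψ) (μs i)) h2).add h1
  rw [zero_add] at h3
  refine h3.congr fun i => ?_
  rw [← integral_add (integrable_zeroAtInfty _ _) (integrable_zeroAtInfty _ _)]
  simp

theorem tendsto_coagWeak_zeroAtInfty {ι : Type*} {l : Filter ι} (hK : SublinearKernel a K)
    {ψs : ι → C₀(PosReal, ℝ)} {ψ : C₀(PosReal, ℝ)} {μs : ι → FiniteMeasure PosReal}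
    {μ : FiniteMeasure PosReal} (hμs : ∀ i, μs i ∈ boundedMoment a M) (hμM : μ ∈ boundedMoment a M)
    (hψ : Tendsto ψs l (𝓝 ψ)) (hμ : Tendsto μs l (𝓝 μ)) :
    Tendsto (fun i => coagWeak K (ψs i) (μs i : Measure PosReal)) l
      (𝓝 (coagWeak K ψ (μ : Measure PosReal))) := by
  obtain ⟨A, hA0, hA⟩ := hK.exists_abs_le_mul
  have h1 : Tendsto (fun i => coagWeak K ψ.toBCF (μs i : Measure PosReal)) l
      (𝓝 (coagWeak K ψ.toBCF (μ : Measure PosReal))) := by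
    refine tendsto_coagWeak hK (fun _ => hK.continuous) (fun _ => hA) ?_ hμs hμM hμ ψ.toBCF
    intro m ε hε hm
    refine Eventually.of_forall fun _ x y hx hy => ?_
    have h0 : 0 ≤ ε * ((x : ℝ) * y) := by
      have := x.2
      have := y.2
      positivity
    rw [abs_of_nonneg (sub_nonneg.2 (min_le_left _ _)), sub_le_iff_le_add, truncKernel,
      ← min_add_add_left]
    exact le_min (by linarith) (by linarith [hm x y hx hy])
  have h2 : Tendsto (fun i => 3 / 2 * A * (M : ℝ) ^ 2 * ‖ψs i - ψ‖) l (𝓝 0) := by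
    simpa using (tendsto_iff_norm_sub_tendsto_zero.1 hψ).const_mul (3 / 2 * A * (M : ℝ) ^ 2)
  have h3 := (squeeze_zero_norm
    (fun i => abs_coagWeak_le hA0 hA (hμs i) (ψs i - ψ).toBCF) h2).add h1
  rw [zero_add] at h3
  refine h3.congr fun i => ?_
  rw [← eq_sub_iff_add_eq]
  exact (coagWeak_sub hK.continuous hA (hμs i) (ψs i).toBCF ψ.toBCF).symm

/-- Weak continuity of `f` makes the rate continuous in time, so the integral equation can be
differentiated. -/
theorem hasDerivAt_integral_const {η f₀ : FiniteMeasure PosReal} {f : ℝ → FiniteMeasure PosReal}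
    (hK : SublinearKernel a K) (hfM : ∀ t, f t ∈ boundedMoment a M) (hf : Continuous f)
    (hint : ∀ φ : PosReal →ᵇ ℝ, ∀ t ∈ Icc 0 T,
      ∫ x, φ x ∂(f t : Measure PosReal) - ∫ x, φ x ∂(f₀ : Measure PosReal) =
        ∫ s in (0)..t, rate K η φ (f s)) (ψ : C₀(PosReal, ℝ)) {t : ℝ} (ht : t ∈ Ioo 0 T) :
    HasDerivAt (fun s => ∫ x, ψ x ∂(f s : Measure PosReal)) (rate K η ψ.toBCF (f t)) t := by
  have hr : Continuous fun s => rate K η ψ.toBCF (f s) :=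
    (continuous_iff_continuousAt.2 fun s =>
      tendsto_coagWeak_zeroAtInfty hK hfM (hfM s) tendsto_const_nhds (hf.tendsto s)).add
        continuous_const
  have h1 : HasDerivAt (fun s => (∫ r in (0)..s, rate K η ψ.toBCF (f r)) +
      ∫ x, ψ x ∂(f₀ : Measure PosReal)) (rate K η ψ.toBCF (f t)) t :=
    (hr.integral_hasStrictDerivAt 0 t).hasDerivAt.add_const _
  refine h1.congr_of_eventuallyEq ?_
  filter_upwards [Icc_mem_nhds ht.1 ht.2] with s hs
  exact sub_eq_iff_eq_add.1 (hint ψ.toBCF s hs)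

/-- Product rule for `t ↦ ∫ φ t d(f t)`. -/
theorem hasDerivAt_integral {η f₀ : FiniteMeasure PosReal} {f : ℝ → FiniteMeasure PosReal}
    (hK : SublinearKernel a K) (hfM : ∀ t, f t ∈ boundedMoment a M) (hf : Continuous f)
    (hint : ∀ φ : PosReal →ᵇ ℝ, ∀ t ∈ Icc 0 T,
      ∫ x, φ x ∂(f t : Measure PosReal) - ∫ x, φ x ∂(f₀ : Measure PosReal) =
        ∫ s in (0)..t, rate K η φ (f s)) {φ : ℝ → C₀(PosReal, ℝ)} {φ' : C₀(PosReal, ℝ)} {t : ℝ}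
    (ht : t ∈ Ioo 0 T) (hφ : HasDerivAt φ φ' t) :
    HasDerivAt (fun s => ∫ x, φ s x ∂(f s : Measure PosReal))
      (∫ x, φ' x ∂(f t : Measure PosReal) + rate K η (φ t).toBCF (f t)) t := by
  -- Write `φ s = (φ s - φ t) + φ t`. The first part vanishes at `s = t`, so its slope is the slope
  -- of `φ` paired with `f s`, and joint continuity gives the limit.
  have h1 : HasDerivAt (fun s => ∫ x, (φ s - φ t) x ∂(f s : Measure PosReal))
      (∫ x, φ' x ∂(f t : Measure PosReal)) t := by
    rw [hasDerivAt_iff_tendsto_slope] at hφ ⊢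
    refine (tendsto_integral_zeroAtInfty hφ
      ((hf.tendsto t).mono_left nhdsWithin_le_nhds)).congr fun s => ?_
    simp only [slope, vsub_eq_sub, sub_self, ZeroAtInftyContinuousMap.zero_apply, integral_zero,
      sub_zero, smul_eq_mul]
    rw [← integral_const_mul]
    rfl
  refine (h1.add (hasDerivAt_integral_const hK hfM hf hint (φ t) ht)).congr_of_eventuallyEq
    (Eventually.of_forall fun s => ?_)
  simp only [Pi.add_apply]
  rw [← integral_add (integrable_zeroAtInfty _ _) (integrable_zeroAtInfty _ _)]
  simp

/-- On `[a, ∞)`, `x ^ p ≤ a ^ (p - 1) * x` for `p ≤ 1`; negative exponents are covered because sizes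
stay away from zero. -/
theorem moment_le {p : ℝ} (hp : p ≤ 1) {μ : FiniteMeasure PosReal} (hμ : μ ∈ boundedMoment a M) :
    moment p (μ : Measure PosReal) ≤ ENNReal.ofReal ((a : ℝ) ^ (p - 1)) * M := by
  refine le_trans ?_ (mul_le_mul_right hμ.2 _)
  rw [← lintegral_const_mul _ measurable_val.ennreal_ofReal]
  refine lintegral_mono_ae ?_
  filter_upwards [hμ.1] with x hx
  rw [← ENNReal.ofReal_mul (Real.rpow_nonneg a.2.le _)]
  refine ENNReal.ofReal_le_ofReal ?_
  simpa using rpow_le_mul_rpow hx hp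

theorem lintegral_moment_lt_top {p : ℝ} (hp : p ≤ 1) {f : ℝ → FiniteMeasure PosReal}
    (hf : ∀ t, f t ∈ boundedMoment a M) :
    ∫⁻ t in Icc (0 : ℝ) T, moment p (f t : Measure PosReal) < ∞ := by
  refine (lintegral_mono fun t => moment_le hp (hf t)).trans_lt ?_
  rw [setLIntegral_const]
  exact ENNReal.mul_lt_top (ENNReal.mul_lt_top ENNReal.ofReal_lt_top ENNReal.coe_lt_top)
    (by simp)

theorem exists_mem_boundedMoment {μ : FiniteMeasure PosReal}
    (h : (μ : Measure PosReal).support ⊆ Ici a) (h1 : moment 1 (μ : Measure PosReal) < ∞) :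
    ∃ M : ℝ≥0, μ ∈ boundedMoment a M := by
  refine ⟨(moment 1 (μ : Measure PosReal)).toNNReal, ?_, ?_⟩
  · filter_upwards [Measure.support_mem_ae (μ := (μ : Measure PosReal))] with x hx using h hx
  · rw [ENNReal.coe_toNNReal h1.ne]
    simp [moment]

/-- Weakly continuous solutions of the integral equation for constant test functions are weak
solutions. -/
theorem isWeakSolution_of_integral_eq {γ lam : ℝ} (hlam : -lam < 1) (hγlam : γ + lam < 1)
    {η f₀ : FiniteMeasure PosReal} {f : ℝ → FiniteMeasure PosReal} (hT : 0 < T)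
    (hK : SublinearKernel a K) (hfM : ∀ t, f t ∈ boundedMoment a M) (hf : Continuous f)
    (hint : ∀ φ : PosReal →ᵇ ℝ, ∀ t ∈ Icc 0 T,
      ∫ x, φ x ∂(f t : Measure PosReal) - ∫ x, φ x ∂(f₀ : Measure PosReal) =
        ∫ s in (0)..t, rate K η φ (f s)) : IsWeakSolution γ lam K T a f₀ η f := by
  obtain ⟨A, hA0, hA⟩ := hK.exists_abs_le_mul
  have hcoag : ∀ φ : ℝ → C₀(PosReal, ℝ), ContinuousOn φ (Icc 0 T) →
      ContinuousOn (fun s => coagWeak K (φ s) (f s : Measure PosReal)) (Icc 0 T) :=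
    fun φ hφ s hs => tendsto_coagWeak_zeroAtInfty hK hfM (hfM s) (hφ s hs)
      hf.continuousAt.continuousWithinAt
  have hpair : ∀ φ : ℝ → C₀(PosReal, ℝ), ∀ g : ℝ → FiniteMeasure PosReal, Continuous g →
      ContinuousOn φ (Icc 0 T) →
      ContinuousOn (fun s => ∫ x, φ s x ∂(g s : Measure PosReal)) (Icc 0 T) :=
    fun φ g hg hφ s hs => tendsto_integral_zeroAtInfty (hφ s hs)
      hg.continuousAt.continuousWithinAt
  refine ⟨fun ψ => hpair (fun _ => ψ) f hf continuousOn_const, fun t _ => ?_, ?_,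
    lintegral_moment_lt_top hlam.le hfM, lintegral_moment_lt_top hγlam.le hfM,
    fun φ _ s _ => integrable_coagIntegrand hK.continuous hA (hfM s) (φ s).toBCF,
    fun φ hφ => ?_, fun φ hφ t ht => ?_⟩
  · exact Measure.support_subset_of_isClosed isClosed_Ici (hfM t).1
  · exact (iSup₂_le fun t _ => moment_le le_rfl (hfM t)).trans_lt
      (ENNReal.mul_lt_top ENNReal.ofReal_lt_top ENNReal.coe_lt_top)
  · refine ContinuousOn.intervalIntegrable ?_
    rw [uIcc_of_le hT.le]
    exact hcoag φ hφ.contDiffOn.continuousOn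
  · have hsub : Icc 0 t ⊆ Icc 0 T := Icc_subset_Icc_right ht.2
    have hφc := hφ.contDiffOn.continuousOn
    have hφ'c : ContinuousOn (timeDeriv T φ) (Icc 0 T) :=
      hφ.contDiffOn.continuousOn_derivWithin (uniqueDiffOn_Icc hT) le_rfl
    have hi : ∀ u : ℝ → ℝ, ContinuousOn u (Icc 0 T) → IntervalIntegrable u volume 0 t :=
      fun u hu => ContinuousOn.intervalIntegrable (by rw [uIcc_of_le ht.1]; exact hu.mono hsub)
    have i1 := hi _ (hpair _ f hf hφ'c)
    have i2 := hi _ (hcoag φ hφc)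
    have i3 := hi _ (hpair φ (fun _ => η) continuous_const hφc)
    have h0 : ∫ x, φ 0 x ∂(f 0 : Measure PosReal) = ∫ x, φ 0 x ∂(f₀ : Measure PosReal) := by
      have := hint (φ 0).toBCF 0 ⟨le_rfl, hT.le⟩
      rw [intervalIntegral.integral_same] at this
      exact sub_eq_zero.1 this
    -- Two-sided derivatives are needed only in the open interval, where `timeDeriv` is the ordinary
    -- derivative; continuity handles the endpoints.
    have hftc := intervalIntegral.integral_eq_sub_of_hasDerivAt_of_le ht.1
      ((hpair φ f hf hφc).mono hsub) (f' := fun s => ∫ x, timeDeriv T φ s x ∂(f s : Measure PosReal) +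
        (coagWeak K (φ s) (f s : Measure PosReal) + ∫ x, φ s x ∂(η : Measure PosReal)))
      (fun s hs => hasDerivAt_integral hK hfM hf hint ⟨hs.1, hs.2.trans_le ht.2⟩
        (((hφ.contDiffOn.differentiableOn one_ne_zero) s
          (hsub ⟨hs.1.le, hs.2.le⟩)).hasDerivWithinAt.hasDerivAt
            (Icc_mem_nhds hs.1 (hs.2.trans_le ht.2)))) (i1.add (i2.add i3))
    rw [intervalIntegral.integral_add i1 (i2.add i3), intervalIntegral.integral_add i2 i3] at hftc
    rw [← h0, ← hftc]
    ring

end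

end Coagulation

end

theorem mainTheorem4 (γ lam : ℝ) (hlam : -lam < 1) (hγlam : γ + lam < 1)
    (K : Coagulation.PosReal → Coagulation.PosReal → ℝ)
    (hK : Coagulation.KernelRegularity γ lam K)
    (a : Coagulation.PosReal) (f₀ η : FiniteMeasure Coagulation.PosReal)
    (hf₀ : (f₀ : Measure Coagulation.PosReal).support ⊆ Ici a)
    (hη : (η : Measure Coagulation.PosReal).support ⊆ Ici a)
    (hf₀_moment : Coagulation.moment 1 (f₀ : Measure Coagulation.PosReal) < ∞)
    (hη_moment : Coagulation.moment 1 (η : Measure Coagulation.PosReal) < ∞)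
    (T : ℝ) (hT : 0 < T) :
    ∃ f : ℝ → FiniteMeasure Coagulation.PosReal,
      Coagulation.IsWeakSolution γ lam K T a f₀ η f := by
  have hKa := hK.sublinearKernel hlam hγlam a
  obtain ⟨M₀, hM₀⟩ := Coagulation.exists_mem_boundedMoment hf₀ hf₀_moment
  obtain ⟨Mη, hMη⟩ := Coagulation.exists_mem_boundedMoment hη hη_moment
  -- The equation is solved for the symmetrized kernel, whose rate agrees with that of `K` along
  -- `f`.
  obtain ⟨M, f, hfM, hf, hint⟩ := Coagulation.exists_integral_solution hKa.symmKernel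
    (fun x y => by rw [Coagulation.symmKernel, Coagulation.symmKernel, add_comm]) hT hMη hM₀
  refine ⟨f, Coagulation.isWeakSolution_of_integral_eq hlam hγlam hT hKa hfM hf
    fun φ t ht => (hint φ t ht).trans ?_⟩
  simp only [Coagulation.rate, Coagulation.coagWeak_symmKernel hKa (hfM _)]
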